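/- For $r>0$ let $\mathbb{S}^2_r\subset\mathbb{R}^3$ be the sphere of radius $r$ centred at the origin, with the chordal (Euclidean) distance. Let $\chi_m(\mathbb{S}^2_r)$ be the least number $k$ of colours for which there is a map $\varphi:\mathbb{S}^2_r\to\{1,\dots,k\}$ such that $\varphi(x)\neq\varphi(y)$ whenever $|x-y|=1$ and every colour class $\varphi^{-1}(i)$ is (Lebesgue) measurable with respect to the surface measure of the sphere. **Theorem 4.1.** Let $x_1,x_2,x_3,x_4$ be points of $\mathbb{S}^2_r$, $x_1\neq x_4$, with $$|x_1-x_2|=|x_1-x_3|=|x_2-x_3|=|x_2-x_4|=|x_3-x_4|=1$$ (a unit-distance "diamond", that is, $K_4$ minus the edge $x_1x_4$). Regard $x_1$ as the north pole, and let $D$ be the radius of the circle traversed by $x_4$ under all rotations of the sphere about the axis through $x_1$. Suppose that $D>\frac12$ and put $\beta=2\arcsin\left(\frac{1}{2D}\right)$. If $\beta=c\pi$ with $c$ irrational, or $\beta=\frac{p}{q}\pi$ with $p,q$ coprime natural numbers, $q\geq 1$ and $p$ even, then $\chi_m(\mathbb{S}^2_r)\geq 5$. -/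

import Mathlib

open MeasureTheory

noncomputable section

/-- Euclidean three-space. -/
abbrev E3 : Type := EuclideanSpace ℝ (Fin 3)

/-- The sphere of radius `r` about the origin, with the chordal metric of three-space. -/
abbrev S2 (r : ℝ) : Type := Metric.sphere (0 : E3) r

/-- The surface measure of the sphere of radius `r`, as a Borel measure on three-space: the image
of Mathlib's surface measure of the unit sphere under the dilation by `r`, times `r ^ 2`. -/
def ambientSurfaceMeasure (r : ℝ) : Measure E3 :=
  ENNReal.ofReal (r ^ 2) •
    (volume : Measure E3).toSphere.map (fun u : Metric.sphere (0 : E3) 1 => r • (u : E3))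

/-- The surface measure on the sphere of radius `r`. -/
def surfaceMeasure (r : ℝ) : Measure (S2 r) :=
  (ambientSurfaceMeasure r).comap Subtype.val

/-- The unit-distance graph of a metric space. -/
def unitDistanceGraph (X : Type*) [MetricSpace X] : SimpleGraph X where
  Adj x y := dist x y = 1
  symm := ⟨fun x y h => by rw [dist_comm]; exact h⟩
  loopless := ⟨fun x h => by simp at h⟩

/-- The unit-distance graph has a proper colouring with `k` colours, all of whose colour classes
are `μ`-measurable, that is, measurable for the completion of `μ` (Lebesgue measurable). -/
def MeasurablyColorable (X : Type*) [MetricSpace X] [MeasurableSpace X] (μ : Measure X)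
    (k : ℕ) : Prop :=
  ∃ φ : (unitDistanceGraph X).Coloring (Fin k), ∀ i : Fin k, NullMeasurableSet (φ ⁻¹' {i}) μ

/-- The measurable chromatic number: the least number of colours (`⊤` if no finite number
suffices). -/
def measurableChromaticNumber (X : Type*) [MetricSpace X] [MeasurableSpace X]
    (μ : Measure X) : ℕ∞ :=
  ⨅ k ∈ {k : ℕ | MeasurablyColorable X μ k}, (k : ℕ∞)

/-- `ρ` is a rotation about the axis through the origin and `p`. -/
def IsRotationAbout (p : E3) (ρ : E3 ≃ₗᵢ[ℝ] E3) : Prop :=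
  ρ p = p ∧ LinearMap.det (ρ.toLinearEquiv : E3 →ₗ[ℝ] E3) = 1

/-- The set that `x` traverses under all rotations about `p`. -/
def tracedSet (p x : E3) : Set E3 :=
  {y | ∃ ρ : E3 ≃ₗᵢ[ℝ] E3, IsRotationAbout p ρ ∧ ρ x = y}

/-- `S` is a circle of radius `R` in three-space: the points at distance `R` from a centre `c`
in a plane through `c` with normal vector `n`. (For `R = 0` it is one point.) -/
def IsCircleOfRadius (S : Set E3) (R : ℝ) : Prop :=
  0 ≤ R ∧ ∃ c n : E3, n ≠ 0 ∧ S = {y | dist y c = R ∧ inner ℝ n (y - c) = 0}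

end

/-! Lift a colouring of the sphere with at most four colours to the nonzero quaternions through `q ↦
rot q (r • axis)`, with `axis` playing the north pole. The lift `c` is invariant under right
multiplication by nonzero complex numbers. The other vertices of a diamond become right translates
`q * g i`, and turning the diamond about its pole replaces `q * g i` by `q * expI t * g i`.

Call a point pure if one colour has density one there. Almost every point is pure by Lebesgue
density, yet a nonzero impure point exists (`exists_ne_zero_forall_not_isPure`), and at least two
colours `i ≠ j` have nonzero density at it (`exists_two_colours`). Suppose that almost all points of
the circles traced by the other three vertices about an impure pole are pure. The two middle
vertices then carry distinct colours other than `i, j`, so the fourth vertex has colour `i` or `j`.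
Points of its circle that differ by the angle `β` are at distance one, hence rotation by `β`
exchanges the two colours almost everywhere. This contradicts ergodicity if `β / π` is irrational,
and parity if the rotation has odd order (`not_ae_flip`).

It remains to find an impure pole whose circles are almost everywhere pure. One circle is a null set
and may be bad, but two successive generic circle steps sweep out enough directions to avoid any
suitable null set (`ae_ae_mul_expI_notMem`). So if an impure pole has a bad circle, almost all
impure points on that circle are good poles. -/

noncomputable section

open Filter Topology Metric Set
open scoped ENNReal Quaternion ComplexConjugate Pointwise

/-! ### Null sets under smooth and linear maps -/

/-- The preimage of a null set under a real function with nonvanishing derivative is null. -/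
theorem volume_preimage_null_of_deriv_ne_zero {f f' : ℝ → ℝ} {N : Set ℝ}
    (hd : ∀ x, HasStrictDerivAt f (f' x) x) (hf' : Continuous f')
    (h0 : volume {x | f' x = 0} = 0) (hN : volume N = 0) : volume (f ⁻¹' N) = 0 := by
  have hf : Continuous f := continuous_iff_continuousAt.2 fun x => (hd x).hasDerivAt.continuousAt
  set N' := toMeasurable volume N with hN'
  have hN'0 : volume N' = 0 := by rw [hN', measure_toMeasurable, hN]
  have hloc : volume (f ⁻¹' N' ∩ {x | f' x ≠ 0}) = 0 := by
    refine measure_null_of_locally_null _ fun x hx => ?_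
    set e := ((hd x).hasStrictFDerivAt_equiv hx.2).toOpenPartialHomeomorph f with he
    have hxe : x ∈ e.source :=
      ((hd x).hasStrictFDerivAt_equiv hx.2).mem_toOpenPartialHomeomorph_source
    refine ⟨(f ⁻¹' N' ∩ {x | f' x ≠ 0}) ∩ e.source,
      inter_mem self_mem_nhdsWithin (mem_nhdsWithin_of_mem_nhds (e.open_source.mem_nhds hxe)), ?_⟩
    set t := (f ⁻¹' N' ∩ {x | f' x ≠ 0}) ∩ e.source with ht
    have htm : MeasurableSet t :=
      ((hf.measurable (measurableSet_toMeasurable _ _)).inter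
        (isOpen_ne_fun hf' continuous_const).measurableSet).inter e.open_source.measurableSet
    have hinj : InjOn f t := fun a ha b hb hab => e.injOn ha.2 hb.2 (by simpa [he] using hab)
    -- Where `f` is injective, `|f'|` integrates over `t` to the measure of the image, which is
    -- zero; as `f' ≠ 0` on `t`, the set `t` is null.
    have key := lintegral_image_eq_lintegral_abs_deriv_mul htm
      (fun y _ => (hd y).hasDerivAt.hasDerivWithinAt) hinj (fun _ => 1)
    have himg : volume (f '' t) = 0 := by
      refine measure_mono_null ?_ hN'0
      rintro _ ⟨y, hy, rfl⟩
      exact hy.1.1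
    simp only [setLIntegral_one, himg, mul_one] at key
    rw [eq_comm, setLIntegral_eq_zero_iff htm (by fun_prop)] at key
    refine measure_mono_null (fun y hy => ?_) key
    intro h
    exact absurd (ENNReal.ofReal_eq_zero.1 (h hy)) (not_le.2 (abs_pos.2 hy.1.2))
  refine measure_mono_null (fun x hx => ?_) (measure_union_null hloc h0)
  by_cases h : f' x = 0
  · exact Or.inr h
  · exact Or.inl ⟨subset_toMeasurable _ _ hx, h⟩

theorem measure_preimage_linearEquiv_null {E F : Type*} [NormedAddCommGroup E] [NormedSpace ℝ E]
    [FiniteDimensional ℝ E] [MeasurableSpace E] [BorelSpace E]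
    [NormedAddCommGroup F] [NormedSpace ℝ F]
    [FiniteDimensional ℝ F] [MeasurableSpace F] [BorelSpace F] (μ : Measure E)
    [μ.IsAddHaarMeasure] (ν : Measure F) [ν.IsAddHaarMeasure] (L : E ≃ₗ[ℝ] F) {N : Set F}
    (hN : ν N = 0) : μ (L ⁻¹' N) = 0 := by
  have : (μ.map L).IsAddHaarMeasure := L.toContinuousLinearEquiv.isAddHaarMeasure_map μ
  have h := Measure.absolutelyContinuous_isAddHaarMeasure (μ.map L) ν
  have h2 := h hN
  have h3 := (L.toContinuousLinearEquiv.toHomeomorph.toMeasurableEquiv).map_apply (μ := μ) N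
  exact h3.symm.trans h2

/-! ### Proportions of sets in balls and points of intermediate density -/

/-- The proportion of the closed ball of radius `ρ` about `x` that lies in `s`. -/
def ballRatio {E : Type*} [PseudoMetricSpace E] [MeasurableSpace E] (μ : Measure E) (s : Set E)
    (x : E) (ρ : ℝ) : ℝ≥0∞ :=
  μ (s ∩ closedBall x ρ) / μ (closedBall x ρ)

theorem ballRatio_add_compl {E : Type*} [NormedAddCommGroup E] [NormedSpace ℝ E]
    [FiniteDimensional ℝ E] [MeasurableSpace E] (μ : Measure E) [μ.IsAddHaarMeasure] {s : Set E}
    (hs : NullMeasurableSet s μ)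
    (x : E) {ρ : ℝ} (hρ : 0 < ρ) :
    ballRatio μ s x ρ + ballRatio μ sᶜ x ρ = 1 := by
  unfold ballRatio
  rw [← ENNReal.add_div, inter_comm, inter_comm sᶜ, ← sdiff_eq,
    measure_inter_add_sdiff₀ _ hs]
  exact ENNReal.div_self (measure_closedBall_pos μ x hρ).ne' measure_closedBall_lt_top.ne

section Density

variable {E : Type*} [NormedAddCommGroup E] [NormedSpace ℝ E] [FiniteDimensional ℝ E]
  [MeasurableSpace E] [BorelSpace E] (μ : Measure E) [μ.IsAddHaarMeasure]

/-- Dominated convergence: the indicators of the moving balls converge off the limiting sphere,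
which is null. -/
theorem continuous_measure_inter_closedBall [Nontrivial E] {s : Set E} (hs : MeasurableSet s)
    (ρ : ℝ) : Continuous fun x => μ (s ∩ closedBall x ρ) := by
  rw [continuous_iff_continuousAt]
  intro x
  refine tendsto_measure_of_ae_tendsto_indicator (𝓝 x) (hs.inter measurableSet_closedBall)
    (fun i => hs.inter measurableSet_closedBall) (B := closedBall x (ρ + 1))
    measurableSet_closedBall measure_closedBall_lt_top.ne ?_ ?_
  · filter_upwards [ball_mem_nhds x one_pos] with y hy
    refine inter_subset_right.trans (closedBall_subset_closedBall' ?_)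
    have := mem_ball.1 hy
    linarith
  · have h0 : ∀ᵐ z ∂μ, z ∉ sphere x ρ := by
      rw [ae_iff]
      simp only [not_not]
      exact Measure.addHaar_sphere μ x ρ
    filter_upwards [h0] with z hz
    have hne : dist z x ≠ ρ := hz
    have hc : Continuous fun y : E => dist z y := by fun_prop
    rcases lt_or_gt_of_ne hne with h | h
    · filter_upwards [hc.continuousAt.eventually_lt continuousAt_const h] with y hy
      simp [h.le, hy.le]
    · filter_upwards [continuousAt_const.eventually_lt hc.continuousAt h] with y hy
      simp [not_le.2 h, not_le.2 hy]

theorem ae_mem_imp_ballRatio_tendsto_one {s : Set E} (hs : MeasurableSet s) :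
    ∀ᵐ x ∂μ, (x ∈ s → Tendsto (ballRatio μ s x) (𝓝[>] 0) (𝓝 1)) ∧
      (x ∉ s → Tendsto (ballRatio μ s x) (𝓝[>] 0) (𝓝 0)) := by
  filter_upwards [Besicovitch.ae_tendsto_measure_inter_div_of_measurableSet μ hs] with x hx
  refine ⟨fun h => ?_, fun h => ?_⟩
  · rw [indicator_of_mem h] at hx
    exact hx
  · rw [indicator_of_notMem h] at hx
    exact hx

/-- On a segment from a density point of `s` to a density point of the complement there are
arbitrarily small balls that are split evenly. -/
theorem exists_ball_half [Nontrivial E] {s U : Set E} (hs : MeasurableSet s) (hU : IsOpen U)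
    {a b : E} (hab : segment ℝ a b ⊆ U)
    (ha : Tendsto (ballRatio μ s a) (𝓝[>] 0) (𝓝 1))
    (hb : Tendsto (ballRatio μ s b) (𝓝[>] 0) (𝓝 0)) {R : ℝ} (hR : 0 < R) :
    ∃ y ρ, 0 < ρ ∧ ρ < R ∧ closedBall y ρ ⊆ U ∧ ballRatio μ s y ρ = 1 / 2 := by
  have hK : IsCompact (segment ℝ a b) := by
    rw [segment_eq_image_lineMap]
    exact isCompact_Icc.image (by fun_prop)
  obtain ⟨δ, hδ, hδU⟩ := hK.exists_cthickening_subset_open hU hab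
  have h1 : ∀ᶠ ρ in 𝓝[>] (0 : ℝ), 1 / 2 < ballRatio μ s a ρ :=
    ha.eventually_const_lt (by simp)
  have h2 : ∀ᶠ ρ in 𝓝[>] (0 : ℝ), ballRatio μ s b ρ < 1 / 2 :=
    hb.eventually_lt_const (by simp)
  have h3 : ∀ᶠ ρ in 𝓝[>] (0 : ℝ), ρ ∈ Ioo 0 (min R δ) :=
    Ioo_mem_nhdsGT (lt_min hR hδ)
  obtain ⟨ρ, hρ1, hρ2, hρ⟩ := (h1.and (h2.and h3)).exists
  have hcont : Continuous fun x => ballRatio μ s x ρ := by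
    unfold ballRatio
    simp only [Measure.addHaar_closedBall_center]
    exact ENNReal.continuous_div_const _ (measure_closedBall_pos μ 0 hρ.1).ne' |>.comp
      (continuous_measure_inter_closedBall μ hs ρ)
  obtain ⟨y, hy, hy2⟩ := (convex_segment a b).isPreconnected.intermediate_value
    (right_mem_segment ℝ a b) (left_mem_segment ℝ a b) hcont.continuousOn ⟨hρ2.le, hρ1.le⟩
  refine ⟨y, ρ, hρ.1, hρ.2.trans_le (min_le_left _ _), ?_, hy2⟩
  refine (closedBall_subset_cthickening hy ρ).trans ((cthickening_mono ?_ _).trans hδU)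
  exact (hρ.2.trans_le (min_le_right _ _)).le

/-- Since the bounding sphere is null, both `s` and its complement have positive measure in the open
ball, hence density points there; the ball is convex, so the segment joining them stays inside.
Halving the radius makes the construction iterable. -/
theorem exists_subball_half [Nontrivial E] {s : Set E} (hs : MeasurableSet s) (x : E) {r : ℝ}
    (hr : 0 < r) (hx : ballRatio μ s x r = 1 / 2) :
    ∃ y ρ, 0 < ρ ∧ ρ < r / 2 ∧ closedBall y ρ ⊆ closedBall x r ∧ ballRatio μ s y ρ = 1 / 2 := by
  have hx' : ballRatio μ sᶜ x r = 1 / 2 := by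
    have h := ballRatio_add_compl μ hs.nullMeasurableSet x hr
    rw [hx] at h
    have h2 : (1 / 2 : ℝ≥0∞) + 1 / 2 = 1 := ENNReal.add_halves 1
    exact (ENNReal.add_right_inj (by simp)).1 (h.trans h2.symm)
  have hpt : ∀ t : Set E, ballRatio μ t x r = 1 / 2 → μ (t ∩ ball x r) ≠ 0 := by
    intro t ht h0
    have : μ (t ∩ closedBall x r) = 0 := by
      rw [← ball_union_sphere, inter_union_distrib_left]
      exact measure_union_null h0 (measure_mono_null inter_subset_right
        (Measure.addHaar_sphere μ x r))
    rw [ballRatio, this, ENNReal.zero_div] at ht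
    exact absurd ht.symm (by simp)
  have hae := ae_mem_imp_ballRatio_tendsto_one μ hs
  obtain ⟨a, ha, ha2⟩ := (((frequently_ae_mem_iff).2 (hpt s hx)).and_eventually hae).exists
  obtain ⟨b, hb, hb2⟩ := (((frequently_ae_mem_iff).2 (hpt sᶜ hx')).and_eventually hae).exists
  obtain ⟨y, ρ, h0, h1, h2, h3⟩ := exists_ball_half μ hs isOpen_ball
    ((convex_ball x r).segment_subset ha.2 hb.2) (ha2.1 ha.1) (hb2.2 hb.1) (half_pos hr)
  exact ⟨y, ρ, h0, h1, h2.trans ball_subset_closedBall, h3⟩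

theorem ballRatio_le_of_subset {s : Set E} {x y : E} {ρ : ℝ} (hρ : 0 < ρ)
    (hxy : x ∈ closedBall y ρ) :
    ENNReal.ofReal ((1 / 2) ^ Module.finrank ℝ E) * ballRatio μ s y ρ ≤
      ballRatio μ s x (2 * ρ) := by
  have hsub : closedBall y ρ ⊆ closedBall x (2 * ρ) := by
    refine closedBall_subset_closedBall' ?_
    have := mem_closedBall'.1 hxy
    linarith
  unfold ballRatio
  rw [Measure.addHaar_closedBall_center μ y, Measure.addHaar_closedBall_center μ x,
    Measure.addHaar_closedBall_mul μ 0 two_pos.le hρ.le]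
  have h2 : ENNReal.ofReal ((1 / 2 : ℝ) ^ Module.finrank ℝ E) =
      (ENNReal.ofReal (2 ^ Module.finrank ℝ E))⁻¹ := by
    rw [← ENNReal.ofReal_inv_of_pos (by positivity)]
    simp
  rw [h2, ENNReal.div_eq_inv_mul, ENNReal.div_eq_inv_mul, ← mul_assoc,
    ENNReal.mul_inv (Or.inr measure_closedBall_lt_top.ne)
      (Or.inr (measure_closedBall_pos μ 0 hρ).ne')]
  gcongr

/-- Between a density point of `s` and a density point of its complement there is a point at which
neither `s` nor its complement has density zero. -/
theorem exists_not_ballRatio_tendsto_zero [Nontrivial E] {s U : Set E} (hs : MeasurableSet s)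
    (hU : IsOpen U) {a b : E} (hab : segment ℝ a b ⊆ U)
    (ha : Tendsto (ballRatio μ s a) (𝓝[>] 0) (𝓝 1))
    (hb : Tendsto (ballRatio μ s b) (𝓝[>] 0) (𝓝 0)) :
    ∃ x ∈ U, ¬ Tendsto (ballRatio μ s x) (𝓝[>] 0) (𝓝 0) ∧
      ¬ Tendsto (ballRatio μ sᶜ x) (𝓝[>] 0) (𝓝 0) := by
  obtain ⟨y₀, ρ₀, hρ₀, -, hsub₀, hhalf₀⟩ := exists_ball_half μ hs hU hab ha hb one_pos
  -- Nested evenly split balls shrink to a point `x`. At radius twice that of the n-th ball, both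
  -- sets occupy at least `2 ^ (-dim) / 2` of the ball about `x`, so neither has density zero.
  let S := {p : E × ℝ // 0 < p.2 ∧ ballRatio μ s p.1 p.2 = 1 / 2}
  have hstep : ∀ p : S, ∃ q : S, q.1.2 < p.1.2 / 2 ∧
      closedBall q.1.1 q.1.2 ⊆ closedBall p.1.1 p.1.2 := by
    rintro ⟨⟨x, r⟩, hr, hx⟩
    obtain ⟨y, ρ, h1, h2, h3, h4⟩ := exists_subball_half μ hs x hr hx
    exact ⟨⟨(y, ρ), h1, h4⟩, h2, h3⟩
  choose next hnext1 hnext2 using hstep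
  let seq : ℕ → S := fun n => Nat.rec ⟨(y₀, ρ₀), hρ₀, hhalf₀⟩ (fun _ p => next p) n
  have hseq : ∀ n, seq (n + 1) = next (seq n) := fun n => rfl
  have hanti : Antitone fun n => closedBall (seq n).1.1 (seq n).1.2 :=
    antitone_nat_of_succ_le fun n => by rw [hseq]; exact hnext2 _
  have hrad : ∀ n, (seq n).1.2 ≤ ρ₀ * (1 / 2) ^ n := by
    intro n
    induction n with
    | zero => simp [seq]
    | succ n ih =>
      have := hnext1 (seq n)
      rw [hseq, pow_succ]
      linarith
  have hpos : ∀ n, 0 < (seq n).1.2 := fun n => (seq n).2.1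
  have : ProperSpace E := FiniteDimensional.proper ℝ E
  obtain ⟨x, hx⟩ := IsCompact.nonempty_iInter_of_sequence_nonempty_isCompact_isClosed
    (fun n => closedBall (seq n).1.1 (seq n).1.2) (fun n => hanti n.le_succ)
    (fun n => ⟨_, mem_closedBall_self (hpos n).le⟩) (isCompact_closedBall _ _)
    (fun n => isClosed_closedBall)
  rw [mem_iInter] at hx
  have hlim0 : Tendsto (fun n => 2 * (seq n).1.2) atTop (𝓝 0) := by
    have h : Tendsto (fun n : ℕ => 2 * (ρ₀ * (1 / 2 : ℝ) ^ n)) atTop (𝓝 (2 * (ρ₀ * 0))) :=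
      ((tendsto_pow_atTop_nhds_zero_of_lt_one (by norm_num) (by norm_num)).const_mul _).const_mul _
    simp only [mul_zero] at h
    exact squeeze_zero (fun n => by linarith [hpos n]) (fun n => by linarith [hrad n]) h
  have hlim : Tendsto (fun n => 2 * (seq n).1.2) atTop (𝓝[>] 0) :=
    tendsto_nhdsWithin_iff.2 ⟨hlim0, Eventually.of_forall fun n => by
      have := hpos n
      simp only [mem_Ioi]
      linarith⟩
  have key : ∀ t : Set E, (∀ n, ballRatio μ t (seq n).1.1 (seq n).1.2 = 1 / 2) →
      ¬ Tendsto (ballRatio μ t x) (𝓝[>] 0) (𝓝 0) := by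
    intro t ht h
    have h1 := h.comp hlim
    have hc : (0 : ℝ≥0∞) < ENNReal.ofReal ((1 / 2) ^ Module.finrank ℝ E) * (1 / 2) := by
      refine ENNReal.mul_pos ?_ (by simp)
      rw [ne_eq, ENNReal.ofReal_eq_zero, not_le]
      positivity
    obtain ⟨n, hn⟩ := (h1.eventually_lt_const hc).exists
    have := ballRatio_le_of_subset μ (s := t) (hpos n) (hx n)
    rw [ht n] at this
    exact absurd hn (not_lt.2 this)
  refine ⟨x, hsub₀ (hx 0), key s fun n => (seq n).2.2, key sᶜ fun n => ?_⟩
  have h := ballRatio_add_compl μ hs.nullMeasurableSet (seq n).1.1 (hpos n)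
  rw [(seq n).2.2] at h
  have h2 : (1 / 2 : ℝ≥0∞) + 1 / 2 = 1 := ENNReal.add_halves 1
  exact (ENNReal.add_right_inj (by simp)).1 (h.trans h2.symm)

end Density

/-! ### Generic points on circles in the quaternions -/

instance : MeasurableSpace ℍ[ℝ] := borel _

instance : BorelSpace ℍ[ℝ] := ⟨rfl⟩

instance : SecondCountableTopology ℍ[ℝ] :=
  Quaternion.linearIsometryEquivTuple.toHomeomorph.secondCountableTopology

instance isAddHaarMeasure_volume_prod {E F : Type*} [AddGroup E] [TopologicalSpace E]
    [MeasureSpace E] [(volume : Measure E).IsAddHaarMeasure] [SFinite (volume : Measure E)]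
    [AddGroup F] [TopologicalSpace F] [MeasureSpace F] [(volume : Measure F).IsAddHaarMeasure]
    [SFinite (volume : Measure F)] [MeasurableAdd E] [MeasurableAdd F] :
    (volume : Measure (E × F)).IsAddHaarMeasure :=
  inferInstanceAs ((volume : Measure E).prod (volume : Measure F)).IsAddHaarMeasure

namespace Quaternion

/-- Left multiplication by a nonzero quaternion. -/
def mulLeftEquiv (q : ℍ[ℝ]) (hq : q ≠ 0) : ℍ[ℝ] ≃ₗ[ℝ] ℍ[ℝ] :=
  LinearEquiv.ofLinearMap (LinearMap.mulLeft ℝ q) (LinearMap.mulLeft ℝ q⁻¹)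
    (LinearMap.ext fun x => by simp [mul_inv_cancel_left₀ hq])
    (LinearMap.ext fun x => by simp [inv_mul_cancel_left₀ hq])

/-- Right multiplication by a nonzero quaternion. -/
def mulRightEquiv (q : ℍ[ℝ]) (hq : q ≠ 0) : ℍ[ℝ] ≃ₗ[ℝ] ℍ[ℝ] :=
  LinearEquiv.ofLinearMap (LinearMap.mulRight ℝ q) (LinearMap.mulRight ℝ q⁻¹)
    (LinearMap.ext fun x => by simp [inv_mul_cancel_right₀ hq])
    (LinearMap.ext fun x => by simp [mul_inv_cancel_right₀ hq])

@[simp] theorem mulRightEquiv_apply (q : ℍ[ℝ]) (hq : q ≠ 0) (x : ℍ[ℝ]) :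
    mulRightEquiv q hq x = x * q := rfl

theorem volume_preimage_mul_left {q : ℍ[ℝ]} (hq : q ≠ 0) {N : Set ℍ[ℝ]} (hN : volume N = 0) :
    volume {x | q * x ∈ N} = 0 :=
  measure_preimage_linearEquiv_null volume volume (mulLeftEquiv q hq) hN

theorem volume_preimage_mul_right {q : ℍ[ℝ]} (hq : q ≠ 0) {N : Set ℍ[ℝ]} (hN : volume N = 0) :
    volume {x | x * q ∈ N} = 0 :=
  measure_preimage_linearEquiv_null volume volume (mulRightEquiv q hq) hN

/-- The quaternion `z + w j`. -/
def mkComplex (z w : ℂ) : ℍ[ℝ] := ⟨z.re, z.im, w.re, w.im⟩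

@[simp] theorem re_mkComplex (z w : ℂ) : (mkComplex z w).re = z.re := rfl

@[simp] theorem imI_mkComplex (z w : ℂ) : (mkComplex z w).imI = z.im := rfl

@[simp] theorem imJ_mkComplex (z w : ℂ) : (mkComplex z w).imJ = w.re := rfl

@[simp] theorem imK_mkComplex (z w : ℂ) : (mkComplex z w).imK = w.im := rfl

/-- Moving `c` past `j` conjugates it. -/
theorem mkComplex_mul_coe (z w c : ℂ) :
    mkComplex z w * (c : ℍ[ℝ]) = mkComplex (z * c) (w * conj c) := by
  ext <;> simp

theorem coe_mul_mkComplex (z w c : ℂ) :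
    (c : ℍ[ℝ]) * mkComplex z w = mkComplex (c * z) (c * w) := by
  ext <;> simp

theorem mkComplex_mul_mkComplex (a b a' b' : ℂ) :
    mkComplex a b * mkComplex a' b' =
      mkComplex (a * a' - b * conj b') (a * b' + b * conj a') := by
  ext <;> simp <;> ring

theorem norm_mkComplex_sq (z w : ℂ) : ‖mkComplex z w‖ ^ 2 = ‖z‖ ^ 2 + ‖w‖ ^ 2 := by
  rw [sq, ← Quaternion.normSq_eq_norm_mul_self, Quaternion.normSq_def', ← Complex.normSq_eq_norm_sq,
    ← Complex.normSq_eq_norm_sq, Complex.normSq_apply, Complex.normSq_apply]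
  simp
  ring

/-- The coordinates `(w, z) ↦ z + w j` as a linear equivalence. -/
def mkComplexEquiv : (ℂ × ℂ) ≃ₗ[ℝ] ℍ[ℝ] where
  toFun p := mkComplex p.2 p.1
  invFun q := (⟨q.imJ, q.imK⟩, ⟨q.re, q.imI⟩)
  map_add' p q := by ext <;> simp
  map_smul' c p := by ext <;> simp
  left_inv p := rfl
  right_inv q := rfl

/-- The unit quaternion `cos t + i sin t`. -/
def expI (t : ℝ) : ℍ[ℝ] := (Complex.exp (t * Complex.I) : ℂ)

theorem expI_add (s t : ℝ) : expI (s + t) = expI s * expI t := by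
  simp only [expI, ← Quaternion.coeComplex_mul, ← Complex.exp_add]
  congr 2
  push_cast
  ring

theorem continuous_expI : Continuous expI := by
  have h : Continuous fun z : ℂ => (z : ℍ[ℝ]) := by
    have := (Quaternion.ofComplex.toLinearMap).continuous_of_finiteDimensional
    exact this
  unfold expI
  exact h.comp (by fun_prop)

theorem norm_coeComplex (z : ℂ) : ‖(z : ℍ[ℝ])‖ = ‖z‖ := by
  have : (z : ℍ[ℝ]) = mkComplex z 0 := by ext <;> simp
  rw [this, ← sq_eq_sq₀ (norm_nonneg _) (norm_nonneg _), norm_mkComplex_sq]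
  simp

theorem norm_expI (t : ℝ) : ‖expI t‖ = 1 := by
  rw [expI, norm_coeComplex, Complex.norm_exp_ofReal_mul_I]

theorem expI_ne_zero (t : ℝ) : expI t ≠ 0 := by
  rw [← norm_ne_zero_iff, norm_expI]
  exact one_ne_zero

theorem continuous_coeComplex : Continuous fun z : ℂ => (z : ℍ[ℝ]) :=
  (Quaternion.ofComplex.toLinearMap).continuous_of_finiteDimensional

theorem coeComplex_ne_zero {c : ℂ} (hc : c ≠ 0) : (c : ℍ[ℝ]) ≠ 0 := by
  rwa [← norm_ne_zero_iff, norm_coeComplex, norm_ne_zero_iff]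

/-- Almost every two-sided translate of `p` by complex numbers avoids `N`. -/
def AvoidsGenerically (N : Set ℍ[ℝ]) (p : ℍ[ℝ]) : Prop :=
  ∀ᵐ x : ℝ × ℂ, expI x.1 * p * (x.2 : ℍ[ℝ]) ∉ N

theorem ae_ne_zero_snd : ∀ᵐ x : ℝ × ℂ, x.2 ≠ 0 := by
  have h : ∀ᵐ c : ℂ, c ≠ 0 := by
    rw [ae_iff]
    simp
  exact Measure.quasiMeasurePreserving_snd.ae h

/-- Fubini: for fixed parameters with nonzero complex factor, `p ↦ expI t * p * c` is a linear
automorphism and pulls null sets back to null sets. -/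
theorem ae_avoidsGenerically {N : Set ℍ[ℝ]} (hN : MeasurableSet N) (h0 : volume N = 0) :
    ∀ᵐ p, AvoidsGenerically N p := by
  have hm : MeasurableSet {y : (ℝ × ℂ) × ℍ[ℝ] | expI y.1.1 * y.2 * (y.1.2 : ℍ[ℝ]) ∉ N} := by
    have hc : Continuous fun y : (ℝ × ℂ) × ℍ[ℝ] => expI y.1.1 * y.2 * (y.1.2 : ℍ[ℝ]) :=
      ((continuous_expI.comp (by fun_prop)).mul (by fun_prop)).mul
        (continuous_coeComplex.comp (by fun_prop))
    exact hc.measurable hN.compl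
  have h := (Measure.ae_ae_comm (μ := (volume : Measure (ℝ × ℂ))) (ν := (volume : Measure ℍ[ℝ]))
    (p := fun x p => expI x.1 * p * (x.2 : ℍ[ℝ]) ∉ N) hm).1 ?_
  · exact h
  · filter_upwards [ae_ne_zero_snd] with x hx
    rw [ae_iff]
    simp only [not_not]
    have h1 := volume_preimage_mul_right (coeComplex_ne_zero hx) h0
    exact volume_preimage_mul_left (expI_ne_zero x.1) h1

theorem AvoidsGenerically.mul_coe {N : Set ℍ[ℝ]} {p : ℍ[ℝ]} (h : AvoidsGenerically N p) {c : ℂ}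
    (hc : c ≠ 0) : AvoidsGenerically N (p * (c : ℍ[ℝ])) := by
  have key := measure_preimage_linearEquiv_null volume volume
    ((LinearEquiv.refl ℝ ℝ).prodCongr (LinearEquiv.smulOfNeZero ℂ ℂ c hc |>.restrictScalars ℝ)) h
  rw [AvoidsGenerically, ae_iff]
  convert key using 2
  ext x
  simp [mul_assoc]

theorem AvoidsGenerically.expI_mul {N : Set ℍ[ℝ]} {p : ℍ[ℝ]} (h : AvoidsGenerically N p) (t : ℝ) :
    AvoidsGenerically N (expI t * p) := by
  have key := (measurePreserving_add_right (volume : Measure (ℝ × ℂ))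
    (t, 0)).quasiMeasurePreserving.ae h
  filter_upwards [key] with x hx
  simpa [expI_add, mul_assoc] using hx

/-- If `v ^ 2 = u` with `|v| = 1`, then `v (z + w j) v = u z + w j`. Together with
`AvoidsGenerically.mul_coe` this makes the property depend only on `|z| / |w|` when `z` and `w` are
nonzero. -/
theorem AvoidsGenerically.rotate {N : Set ℍ[ℝ]} {z w u : ℂ}
    (h : AvoidsGenerically N (mkComplex z w)) (hu : ‖u‖ = 1) :
    AvoidsGenerically N (mkComplex (u * z) w) := by
  obtain ⟨θ, hθ⟩ : ∃ θ : ℝ, Complex.exp (θ * Complex.I) = u := by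
    refine ⟨u.arg, ?_⟩
    have := Complex.norm_mul_exp_arg_mul_I u
    rwa [hu, Complex.ofReal_one, one_mul] at this
  have hv : ‖Complex.exp ((θ / 2 : ℝ) * Complex.I)‖ = 1 := Complex.norm_exp_ofReal_mul_I _
  have hvv : Complex.exp ((θ / 2 : ℝ) * Complex.I) * Complex.exp ((θ / 2 : ℝ) * Complex.I) = u := by
    rw [← Complex.exp_add, ← hθ]
    congr 1
    push_cast
    ring
  have h2 := (h.expI_mul (θ / 2)).mul_coe (Complex.exp_ne_zero ((θ / 2 : ℝ) * Complex.I))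
  convert h2 using 1
  rw [expI, coe_mul_mkComplex, mkComplex_mul_coe]
  congr 1
  · rw [← hvv]
    ring
  · rw [mul_right_comm, Complex.mul_conj, Complex.normSq_eq_norm_sq, hv]
    simp

/-- Fubini fixes `w` so that almost every `z` is good; polar coordinates give a good angle for
almost every radius, and rotation invariance moves it to angle zero. -/
theorem exists_ae_radius_avoidsGenerically {N : Set ℍ[ℝ]} (hN : MeasurableSet N)
    (h0 : volume N = 0) :
    ∃ w : ℂ, w ≠ 0 ∧ volume {ρ : ℝ | 0 < ρ ∧ ¬ AvoidsGenerically N (mkComplex ρ w)} = 0 := by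
  have h1 : ∀ᵐ p : ℂ × ℂ, AvoidsGenerically N (mkComplex p.2 p.1) :=
    measure_preimage_linearEquiv_null (volume : Measure (ℂ × ℂ)) volume mkComplexEquiv
      (ae_avoidsGenerically hN h0)
  have h2 : ∀ᵐ c : ℂ, c ≠ 0 := by
    rw [ae_iff]
    simp
  obtain ⟨w, hw, hw0⟩ := ((Measure.ae_ae_of_ae_prod h1).and h2).exists
  refine ⟨w, hw0, ?_⟩
  set Z := toMeasurable volume {z : ℂ | ¬ AvoidsGenerically N (mkComplex z w)} with hZ
  have hZ0 : volume Z = 0 := by rw [hZ, measure_toMeasurable]; exact hw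
  have hZm : MeasurableSet Z := measurableSet_toMeasurable _ _
  have hpol := Complex.lintegral_comp_polarCoord_symm (Z.indicator 1)
  rw [lintegral_indicator_one hZm, hZ0, setLIntegral_eq_zero_iff
    polarCoord.open_target.measurableSet ?_, ← ae_restrict_iff'
    polarCoord.open_target.measurableSet, polarCoord_target, Measure.volume_eq_prod,
    ← Measure.prod_restrict] at hpol
  · have h3 := Measure.ae_ae_of_ae_prod hpol
    rw [ae_restrict_iff' measurableSet_Ioi] at h3
    refine measure_mono_null (fun ρ hρ => ?_) h3
    intro h
    have h4 := h hρ.1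
    have hne : (volume.restrict (Ioo (-Real.pi) Real.pi)) ≠ 0 := by
      rw [ne_eq, Measure.restrict_eq_zero, Real.volume_Ioo, ENNReal.ofReal_eq_zero, not_le]
      linarith [Real.pi_pos]
    have : (ae (volume.restrict (Ioo (-Real.pi) Real.pi))).NeBot := ae_neBot.2 hne
    obtain ⟨θ, hθ⟩ := h4.exists
    have h5 : Complex.polarCoord.symm (ρ, θ) ∉ Z := by
      intro hmem
      rw [indicator_of_mem hmem] at hθ
      simp at hθ
      exact absurd hρ.1 (not_lt.2 hθ)
    have h6 : AvoidsGenerically N (mkComplex (Complex.polarCoord.symm (ρ, θ)) w) := by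
      by_contra hc
      exact h5 (subset_toMeasurable _ _ hc)
    have h7 := h6.rotate (u := Complex.exp ((-θ : ℝ) * Complex.I))
      (Complex.norm_exp_ofReal_mul_I _)
    refine hρ.2 ?_
    convert h7 using 2
    rw [Complex.polarCoord_symm_apply, Complex.ofReal_cos, Complex.ofReal_sin,
      ← Complex.exp_mul_I, mul_left_comm, ← Complex.exp_add]
    simp
  · refine Measurable.smul (f := fun p : ℝ × ℝ => ENNReal.ofReal p.1) (by fun_prop) ?_
    refine (measurable_one.indicator hZm).comp ?_
    have : (fun p : ℝ × ℝ => (Complex.polarCoord.symm p : ℂ)) = fun p : ℝ × ℝ =>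
        (p.1 : ℂ) * (Real.cos p.2 + Real.sin p.2 * Complex.I) := by
      ext p
      rw [Complex.polarCoord_symm_apply]
    change Measurable fun p : ℝ × ℝ => (Complex.polarCoord.symm p : ℂ)
    rw [this]
    fun_prop

theorem volume_preimage_cos_null {A R φ : ℝ} (hR : R ≠ 0) {B : Set ℝ} (hB : volume B = 0) :
    volume {t : ℝ | A - R * Real.cos (2 * t + φ) ∈ B} = 0 := by
  refine volume_preimage_null_of_deriv_ne_zero (f := fun t => A - R * Real.cos (2 * t + φ))
    (f' := fun t => 2 * R * Real.sin (2 * t + φ)) (fun x => ?_) (by fun_prop) ?_ hB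
  · have h1 : HasStrictDerivAt (fun t : ℝ => 2 * t + φ) 2 x := by
      simpa using ((hasStrictDerivAt_id x).const_mul 2).add_const φ
    have h2 := ((h1.cos).const_mul R).const_sub A
    rw [show 2 * R * Real.sin (2 * x + φ) = -(R * (-Real.sin (2 * x + φ) * 2)) by ring]
    exact h2
  · refine Set.Countable.measure_zero (Set.Countable.mono ?_
      (Set.countable_range fun n : ℤ => ((n : ℝ) * Real.pi - φ) / 2)) _
    intro t ht
    have : Real.sin (2 * t + φ) = 0 := by
      have h : 2 * R * Real.sin (2 * t + φ) = 0 := ht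
      simpa [hR] using h
    obtain ⟨n, hn⟩ := Real.sin_eq_zero_iff.1 this
    exact ⟨n, by linarith⟩

/-- `|z|²` along the circle `t ↦ h e(t) h'`, where `h e(t) h' = z + w j`. -/
theorem exists_norm_sq_eq_cos {a b a' b' : ℂ} (ha : a ≠ 0) (hb : b ≠ 0) (ha' : a' ≠ 0)
    (hb' : b' ≠ 0) : ∃ A R φ : ℝ, R ≠ 0 ∧ ∀ t : ℝ,
      ‖a * Complex.exp (t * Complex.I) * a' - b * conj (Complex.exp (t * Complex.I)) * conj b'‖ ^ 2
        = A - R * Real.cos (2 * t + φ) := by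
  -- The cross term in the expansion of the squared norm is `-2 Re (κ e²)`; nonvanishing of all four
  -- coordinates is what makes it oscillate.
  set κ : ℂ := a * a' * conj b * b' with hκ
  have hκ0 : κ ≠ 0 := by simp [hκ, ha, hb, ha', hb']
  refine ⟨‖a * a'‖ ^ 2 + ‖b * b'‖ ^ 2, 2 * ‖κ‖, κ.arg, by simpa using hκ0, fun t => ?_⟩
  set e := Complex.exp (t * Complex.I) with he
  have hen : ‖e‖ = 1 := Complex.norm_exp_ofReal_mul_I t
  have h1 : (a * e * a' * conj (b * conj e * conj b')) = κ * (e * e) := by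
    simp [hκ]
    ring
  have h2 : (κ * (e * e)).re = ‖κ‖ * Real.cos (2 * t + κ.arg) := by
    have h3 : κ * (e * e) = (‖κ‖ : ℂ) * Complex.exp (((2 * t + κ.arg : ℝ) : ℂ) * Complex.I) := by
      conv_lhs => rw [← Complex.norm_mul_exp_arg_mul_I κ]
      rw [he, ← Complex.exp_add, mul_assoc, ← Complex.exp_add]
      congr 2
      push_cast
      ring
    rw [h3, Complex.re_ofReal_mul, Complex.exp_ofReal_mul_I_re]
  rw [← Complex.normSq_eq_norm_sq, Complex.normSq_sub, h1, h2, Complex.normSq_eq_norm_sq,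
    Complex.normSq_eq_norm_sq]
  simp only [norm_mul, hen, RCLike.norm_conj]
  ring

/-- On unit quaternions goodness depends only on `|z|²`, apart from the degenerate values 0 and 1.
Along the circle `|z|²` is a nonconstant cosine, so it meets the null set of bad values only for a
null set of `t`. -/
theorem ae_avoidsGenerically_circle {N : Set ℍ[ℝ]} (hN : MeasurableSet N) (h0 : volume N = 0)
    {a b a' b' : ℂ} (ha : a ≠ 0) (hb : b ≠ 0) (ha' : a' ≠ 0) (hb' : b' ≠ 0)
    (h1 : ‖mkComplex a b‖ = 1) (h1' : ‖mkComplex a' b'‖ = 1) :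
    ∀ᵐ t : ℝ, AvoidsGenerically N (mkComplex a b * expI t * mkComplex a' b') := by
  obtain ⟨w₀, hw₀, hnull⟩ := exists_ae_radius_avoidsGenerically hN h0
  obtain ⟨A, R, φ, hR, hcos⟩ := exists_norm_sq_eq_cos ha hb ha' hb'
  set R₀ := {ρ : ℝ | 0 < ρ ∧ ¬ AvoidsGenerically N (mkComplex ρ w₀)} with hR₀
  -- The values of `|z|²` obtained by normalising the bad `ρ + w₀ j`; 0 and 1 are added to exclude
  -- `z = 0` and `w = 0`.
  set B : Set ℝ := (fun ρ : ℝ => ρ ^ 2 / (‖w₀‖ ^ 2 + ρ ^ 2)) '' R₀ ∪ {0, 1} with hB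
  have hw₀' : 0 < ‖w₀‖ := norm_pos_iff.2 hw₀
  have hB0 : volume B = 0 := by
    refine measure_union_null ?_ (Set.Finite.measure_zero (by simp) _)
    refine addHaar_image_eq_zero_of_differentiableOn_of_addHaar_eq_zero volume ?_ hnull
    intro x _
    refine DifferentiableAt.differentiableWithinAt ?_
    have : ‖w₀‖ ^ 2 + x ^ 2 ≠ 0 := by positivity
    fun_prop (disch := assumption)
  have hae : ∀ᵐ t : ℝ, A - R * Real.cos (2 * t + φ) ∉ B := by
    rw [ae_iff]
    simpa using volume_preimage_cos_null (A := A) (φ := φ) hR hB0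
  filter_upwards [hae] with t ht
  rw [← hcos t] at ht
  set e := Complex.exp (t * Complex.I) with he
  set z := a * e * a' - b * conj e * conj b' with hz
  set w := a * e * b' + b * conj e * conj a' with hw
  have hp : mkComplex a b * expI t * mkComplex a' b' = mkComplex z w := by
    rw [expI, mkComplex_mul_coe, mkComplex_mul_mkComplex]
  have hnorm : ‖z‖ ^ 2 + ‖w‖ ^ 2 = 1 := by
    rw [← norm_mkComplex_sq, ← hp, norm_mul, norm_mul, h1, h1', norm_expI]
    norm_num
  have hz0 : 0 < ‖z‖ := by
    by_contra h
    have : ‖z‖ = 0 := le_antisymm (not_lt.1 h) (norm_nonneg _)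
    exact ht (Or.inr (by simp [this]))
  have hw0 : 0 < ‖w‖ := by
    by_contra h
    have : ‖w‖ = 0 := le_antisymm (not_lt.1 h) (norm_nonneg _)
    rw [this] at hnorm
    exact ht (Or.inr (by right; simp only [mem_singleton_iff]; linarith))
  -- Right multiplication by this `c` brings the second coordinate to `w₀`.
  set c : ℂ := conj (w₀ / w) with hc
  have hwne : w ≠ 0 := norm_pos_iff.1 hw0
  have hc0 : c ≠ 0 := by simp [hc, hw₀, hwne]
  have hwc : w * conj c = w₀ := by
    rw [hc, Complex.conj_conj, mul_div_cancel₀ _ hwne]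
  have hcn : ‖c‖ = ‖w₀‖ / ‖w‖ := by rw [hc, RCLike.norm_conj, norm_div]
  set ρ := ‖z * c‖ with hρ
  have hρe : ρ = ‖z‖ * (‖w₀‖ / ‖w‖) := by rw [hρ, norm_mul, hcn]
  have hρ0 : 0 < ρ := by rw [hρe]; positivity
  have hG : AvoidsGenerically N (mkComplex ρ w₀) := by
    by_contra hcon
    refine ht (Or.inl ⟨ρ, ⟨hρ0, hcon⟩, ?_⟩)
    simp only [hρe]
    have : ‖w₀‖ ^ 2 + (‖z‖ * (‖w₀‖ / ‖w‖)) ^ 2 = ‖w₀‖ ^ 2 / ‖w‖ ^ 2 := by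
      field_simp
      linarith
    rw [this]
    field_simp
  have hzc : (Complex.exp ((z * c).arg * Complex.I)) * (ρ : ℂ) = z * c := by
    rw [mul_comm, hρ, Complex.norm_mul_exp_arg_mul_I]
  have h3 := (hG.rotate (Complex.norm_exp_ofReal_mul_I (z * c).arg)).mul_coe (inv_ne_zero hc0)
  rw [hzc] at h3
  rw [hp]
  have hwe : w = w₀ * conj c⁻¹ := by
    rw [← hwc, mul_assoc, ← map_mul, mul_inv_cancel₀ hc0]
    simp
  have hze : z = z * c * c⁻¹ := (mul_inv_cancel_right₀ hc0 z).symm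
  rw [mkComplex_mul_coe, ← hze, ← hwe] at h3
  exact h3

/-- Two generic steps along circles lead from any starting point out of a null set. -/
theorem ae_ae_mul_expI_notMem {M : Set ℍ[ℝ]} (h0 : volume M = 0)
    (hinv : ∀ p ∈ M, ∀ c : ℂ, c ≠ 0 → p * (c : ℍ[ℝ]) ∈ M) {q : ℍ[ℝ]} (hq : q ≠ 0)
    {a b a' b' : ℂ} (ha : a ≠ 0) (hb : b ≠ 0) (ha' : a' ≠ 0) (hb' : b' ≠ 0)
    (h1 : ‖mkComplex a b‖ = 1) (h1' : ‖mkComplex a' b'‖ = 1) :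
    ∀ᵐ s : ℝ, ∀ᵐ t : ℝ, q * expI s * mkComplex a b * expI t * mkComplex a' b' ∉ M := by
  set N := toMeasurable volume {p | q * p ∈ M} with hN
  have hNm : MeasurableSet N := measurableSet_toMeasurable _ _
  have hN0 : volume N = 0 := by
    rw [hN, measure_toMeasurable]
    exact volume_preimage_mul_left hq h0
  have h := ae_avoidsGenerically_circle hNm hN0 ha hb ha' hb' h1 h1'
  unfold AvoidsGenerically at h
  rw [Measure.ae_ae_comm] at h
  · have h2 := (Measure.ae_ae_of_ae_prod h : ∀ᵐ s : ℝ, ∀ᵐ c : ℂ, _)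
    have h3 : ∀ᵐ c : ℂ, c ≠ 0 := by
      rw [ae_iff]
      simp
    filter_upwards [h2] with s hs
    -- A single nonzero `c` suffices, because `M` is stable under right multiplication by it.
    obtain ⟨c, hc, hc0⟩ := (hs.and h3).exists
    filter_upwards [hc] with t ht hmem
    refine ht (subset_toMeasurable _ _ ?_)
    have := hinv _ hmem c hc0
    simpa only [mem_ofPred_eq, mul_assoc] using this
  · have hc : Continuous fun y : ℝ × ℝ × ℂ =>
        expI y.2.1 * (mkComplex a b * expI y.1 * mkComplex a' b') * (y.2.2 : ℍ[ℝ]) :=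
      ((continuous_expI.comp (by fun_prop)).mul ((continuous_const.mul
        (continuous_expI.comp (by fun_prop))).mul continuous_const)).mul
        (continuous_coeComplex.comp (by fun_prop))
    exact hc.measurable hNm.compl

end Quaternion

/-! ### Rotations exchanging a set with its complement -/

/-- A measurable subset of the circle cannot be exchanged with its complement by a rotation that is
irrational or of odd order. -/
theorem not_ae_flip {A : Set ℝ} (hA : MeasurableSet A) {T b : ℝ} (hT : 0 < T)
    (hper : ∀ t, t + T ∈ A ↔ t ∈ A) (hflip : ∀ᵐ t, (t + b ∈ A ↔ t ∉ A))
    (hb : Irrational (b / T) ∨ ∃ q : ℕ, Odd q ∧ ∃ m : ℕ, q * b = m * T) : False := by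
  rcases hb with hb | ⟨q, hq, m, hqm⟩
  · have : Fact (0 < T) := ⟨hT⟩
    have hP : Function.Periodic (fun t => t ∈ A) T := fun t => propext (hper t)
    let S : Set (AddCircle T) := {x | hP.lift x}
    have hS : ∀ t : ℝ, (t : AddCircle T) ∈ S ↔ t ∈ A := fun t => by
      change hP.lift (t : AddCircle T) ↔ _
      rw [hP.lift_coe]
    have hSm : MeasurableSet S := by
      have : S = AddCircle.measurableEquivIoc T 0 ⁻¹' (Subtype.val ⁻¹' A) := by
        ext x
        rw [mem_preimage, mem_preimage, ← hS]
        change x ∈ S ↔ ((AddCircle.equivIoc T 0 x : ℝ) : AddCircle T) ∈ S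
        rw [AddCircle.coe_equivIoc]
      rw [this]
      exact (AddCircle.measurableEquivIoc T 0).measurable (measurable_subtype_coe hA)
    have hmp := AddCircle.measurePreserving_mk T 0
    have hbm : Measurable fun x : AddCircle T => x + (b : AddCircle T) := by fun_prop
    have hae : ∀ᵐ x : AddCircle T, (x + (b : AddCircle T) ∈ S ↔ x ∉ S) := by
      rw [← hmp.map_eq, ae_map_iff hmp.measurable.aemeasurable]
      · refine ae_restrict_of_ae ?_
        filter_upwards [hflip] with t ht
        have h1 := hS (t + b)
        rw [AddCircle.coe_add] at h1
        exact h1.trans (ht.trans (not_congr (hS t).symm))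
      · have : {x : AddCircle T | x + (b : AddCircle T) ∈ S ↔ x ∉ S} =
            ((fun x => x + (b : AddCircle T)) ⁻¹' S ∩ Sᶜ) ∪
            (((fun x => x + (b : AddCircle T)) ⁻¹' S)ᶜ ∩ S) := by
          ext x
          by_cases h1 : x + (b : AddCircle T) ∈ S <;> by_cases h2 : x ∈ S <;> simp [h1, h2]
        rw [this]
        have := hbm hSm
        measurability
    have hshift : MeasurePreserving (fun x : AddCircle T => x + (b : AddCircle T)) volume volume :=
      measurePreserving_add_right volume _
    have hae2 := hshift.quasiMeasurePreserving.ae hae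
    -- Two flips cancel, so `S` is invariant under rotation by `2b`, which is ergodic. Thus `S` is
    -- null or conull, whereas one flip forces `S` and its complement to have equal measure.
    have hord : addOrderOf ((b + b : ℝ) : AddCircle T) = 0 := by
      by_contra h
      have h1 := addOrderOf_nsmul_eq_zero ((b + b : ℝ) : AddCircle T)
      rw [← AddCircle.coe_nsmul, AddCircle.coe_eq_zero_iff] at h1
      obtain ⟨n, hn⟩ := h1
      set k := addOrderOf ((b + b : ℝ) : AddCircle T)
      apply hb
      refine ⟨n / (2 * k), ?_⟩
      have hk : (k : ℝ) ≠ 0 := by exact_mod_cast h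
      simp only [zsmul_eq_mul, nsmul_eq_mul] at hn
      push_cast
      field_simp
      linarith
    have herg := (AddCircle.ergodic_add_right (p := T)).2 hord
    have hinv : (fun x => x + ((b + b : ℝ) : AddCircle T)) ⁻¹' S =ᵐ[volume] S := by
      rw [eventuallyEq_set]
      filter_upwards [hae, hae2] with x h1 h2
      rw [mem_preimage, AddCircle.coe_add, ← add_assoc, h2, h1, not_not]
    have hcompl : (fun x => x + (b : AddCircle T)) ⁻¹' S =ᵐ[volume] (Sᶜ : Set (AddCircle T)) := by
      rw [eventuallyEq_set]
      filter_upwards [hae] with x h1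
      exact h1
    have hm1 : volume Sᶜ = volume S := by
      rw [← measure_congr hcompl, hshift.measure_preimage hSm.nullMeasurableSet]
    have hsum := measure_add_measure_compl (μ := volume) hSm
    rw [hm1, AddCircle.measure_univ] at hsum
    have hTpos : ENNReal.ofReal T ≠ 0 := by simpa using hT
    rcases herg.quasiErgodic.ae_empty_or_univ₀ hSm.nullMeasurableSet hinv with h | h
    · rw [measure_congr h, measure_empty, add_zero] at hsum
      exact hTpos hsum.symm
    · rw [measure_congr h, AddCircle.measure_univ] at hsum
      have h3 : ENNReal.ofReal T + ENNReal.ofReal T = ENNReal.ofReal T + 0 := by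
        rw [hsum, add_zero]
      exact hTpos ((ENNReal.add_right_inj ENNReal.ofReal_ne_top).1 h3)
  -- After `n` flips membership depends on the parity of `n`. With `n = q` odd the total shift is a
  -- multiple of the period, a contradiction.
  · have hn : ∀ n : ℕ, ∀ᵐ t, (t + n * b ∈ A ↔ (t ∈ A ↔ Even n)) := by
      intro n
      induction n with
      | zero => simp
      | succ n ih =>
        have h2 := (measurePreserving_add_right (volume : Measure ℝ)
          (n * b)).quasiMeasurePreserving.ae hflip
        filter_upwards [ih, h2] with t h3 h4
        rw [Nat.cast_succ, add_mul, one_mul, ← add_assoc, h4, h3, Nat.even_add_one]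
        tauto
    have hm : ∀ n : ℕ, ∀ t, t + n * T ∈ A ↔ t ∈ A := by
      intro n
      induction n with
      | zero => simp
      | succ n ih =>
        intro t
        rw [Nat.cast_succ, add_mul, one_mul, ← add_assoc, hper, ih]
    obtain ⟨t, ht⟩ := (hn q).exists
    rw [hqm, hm] at ht
    have := Nat.not_even_iff_odd.2 hq
    tauto

/-! ### Calculus of densities -/

section HasDensity

variable {E : Type*} [PseudoMetricSpace E] [MeasurableSpace E] {μ : Measure E}

/-- The set `s` has density `l` at `x`. -/
def HasDensity (μ : Measure E) (s : Set E) (x : E) (l : ℝ≥0∞) : Prop :=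
  Tendsto (ballRatio μ s x) (𝓝[>] 0) (𝓝 l)

theorem HasDensity.not_zero {s : Set E} {x : E} (h : HasDensity μ s x 1) :
    ¬ HasDensity μ s x 0 := fun h' =>
  one_ne_zero (tendsto_nhds_unique h h')

theorem HasDensity.mono_zero {s t : Set E} {x : E} (h : HasDensity μ t x 0) (hst : s ≤ᵐ[μ] t) :
    HasDensity μ s x 0 := by
  refine tendsto_of_tendsto_of_tendsto_of_le_of_le tendsto_const_nhds h (fun _ => zero_le)
    fun ρ => ?_
  exact ENNReal.div_le_div_right (measure_mono_ae (hst.mono fun y hy h => ⟨hy h.1, h.2⟩)) _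

theorem HasDensity.union_zero {s t : Set E} {x : E} (hs : HasDensity μ s x 0)
    (ht : HasDensity μ t x 0) : HasDensity μ (s ∪ t) x 0 := by
  have h : Tendsto (fun ρ => ballRatio μ s x ρ + ballRatio μ t x ρ) (𝓝[>] 0) (𝓝 (0 + 0)) :=
    hs.add ht
  rw [add_zero] at h
  refine tendsto_of_tendsto_of_tendsto_of_le_of_le tendsto_const_nhds h (fun _ => zero_le)
    fun ρ => ?_
  simp only [ballRatio]
  rw [← ENNReal.add_div, union_inter_distrib_right]
  exact ENNReal.div_le_div_right (measure_union_le _ _) _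

theorem hasDensity_congr {s t : Set E} {x : E} {l : ℝ≥0∞} (hst : s =ᵐ[μ] t) :
    HasDensity μ s x l ↔ HasDensity μ t x l := by
  have : ballRatio μ s x = ballRatio μ t x := by
    ext ρ
    simp only [ballRatio]
    rw [measure_congr (hst.inter (ae_eq_refl (closedBall x ρ)))]
  rw [HasDensity, HasDensity, this]

end HasDensity

section HasDensityCompl

variable {E : Type*} [NormedAddCommGroup E] [NormedSpace ℝ E] [FiniteDimensional ℝ E]
  [MeasurableSpace E] {μ : Measure E} [μ.IsAddHaarMeasure]

theorem HasDensity.compl {s : Set E} (hs : NullMeasurableSet s μ) {x : E}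
    (h : HasDensity μ s x 1) : HasDensity μ sᶜ x 0 := by
  have h1 : Tendsto (fun ρ => 1 - ballRatio μ s x ρ) (𝓝[>] 0) (𝓝 (1 - 1)) :=
    ENNReal.Tendsto.sub tendsto_const_nhds h (Or.inl ENNReal.one_ne_top)
  rw [tsub_self] at h1
  refine h1.congr' ?_
  filter_upwards [self_mem_nhdsWithin] with ρ hρ
  have h2 := ballRatio_add_compl μ hs x hρ
  rw [← h2]
  refine ENNReal.add_sub_cancel_left ?_
  intro htop
  rw [htop, top_add] at h2
  exact ENNReal.top_ne_one h2

theorem HasDensity.of_compl {s : Set E} (hs : NullMeasurableSet s μ) {x : E}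
    (h : HasDensity μ sᶜ x 0) : HasDensity μ s x 1 := by
  have h1 : Tendsto (fun ρ => 1 - ballRatio μ sᶜ x ρ) (𝓝[>] 0) (𝓝 (1 - 0)) :=
    ENNReal.Tendsto.sub tendsto_const_nhds h (Or.inl ENNReal.one_ne_top)
  rw [tsub_zero] at h1
  refine h1.congr' ?_
  filter_upwards [self_mem_nhdsWithin] with ρ hρ
  have h2 := ballRatio_add_compl μ hs x hρ
  rw [← h2]
  refine ENNReal.add_sub_cancel_right ?_
  intro htop
  rw [htop, add_top] at h2
  exact ENNReal.top_ne_one h2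

end HasDensityCompl

/-! ### Four-colourings of the nonzero quaternions -/

namespace Quaternion

/-- Right multiplication by `g` is a similarity of ratio `‖g‖`, so it carries balls to balls and
scales all volumes by one factor. -/
theorem ballRatio_mul_right (s : Set ℍ[ℝ]) {g : ℍ[ℝ]} (hg : g ≠ 0) (x : ℍ[ℝ]) (ρ : ℝ) :
    ballRatio volume s (x * g) (ρ * ‖g‖) = ballRatio volume {z | z * g ∈ s} x ρ := by
  have hg' : 0 < ‖g‖ := norm_pos_iff.2 hg
  have hball : mulRightEquiv g hg ⁻¹' closedBall (x * g) (ρ * ‖g‖) = closedBall x ρ := by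
    ext z
    simp only [mem_preimage, mem_closedBall, mulRightEquiv_apply, dist_eq_norm]
    rw [← sub_mul, norm_mul, mul_le_mul_iff_left₀ hg']
  have hdet : ENNReal.ofReal |LinearMap.det ((mulRightEquiv g hg).symm : ℍ[ℝ] →ₗ[ℝ] ℍ[ℝ])| ≠ 0 := by
    rw [ne_eq, ENNReal.ofReal_eq_zero, not_le, abs_pos]
    exact (LinearEquiv.isUnit_det' _).ne_zero
  have h1 := Measure.addHaar_preimage_linearEquiv volume (mulRightEquiv g hg)
    (s ∩ closedBall (x * g) (ρ * ‖g‖))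
  have h2 := Measure.addHaar_preimage_linearEquiv volume (mulRightEquiv g hg)
    (closedBall (x * g) (ρ * ‖g‖))
  rw [preimage_inter, hball] at h1
  rw [hball] at h2
  change volume ({z | z * g ∈ s} ∩ closedBall x ρ) = _ at h1
  rw [ballRatio, ballRatio, h1, h2, ENNReal.mul_div_mul_left _ _ hdet ENNReal.ofReal_ne_top]

theorem hasDensity_mul_right (s : Set ℍ[ℝ]) {g : ℍ[ℝ]} (hg : g ≠ 0) (x : ℍ[ℝ]) (l : ℝ≥0∞) :
    HasDensity volume s (x * g) l ↔ HasDensity volume {z | z * g ∈ s} x l := by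
  have hscale : ∀ c : ℝ, 0 < c → Tendsto (fun ρ : ℝ => ρ * c) (𝓝[>] 0) (𝓝[>] 0) := by
    intro c hc
    refine tendsto_nhdsWithin_iff.2 ⟨?_, ?_⟩
    · have : Tendsto (fun ρ : ℝ => ρ * c) (𝓝 0) (𝓝 (0 * c)) := tendsto_id.mul_const c
      rw [zero_mul] at this
      exact this.mono_left nhdsWithin_le_nhds
    · filter_upwards [self_mem_nhdsWithin] with ρ hρ
      exact mul_pos hρ hc
  have hg' : 0 < ‖g‖ := norm_pos_iff.2 hg
  constructor
  · intro h
    refine (h.comp (hscale _ hg')).congr fun ρ => ?_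
    exact ballRatio_mul_right s hg x ρ
  · intro h
    refine (h.comp (hscale _ (inv_pos.2 hg'))).congr fun ρ => ?_
    have := ballRatio_mul_right s hg x (ρ * ‖g‖⁻¹)
    rw [inv_mul_cancel_right₀ hg'.ne'] at this
    exact this.symm

section Colouring

variable {c : ℍ[ℝ] → Fin 4}

/-- Colour `k` has density one at `x`. -/
def IsPure (c : ℍ[ℝ] → Fin 4) (k : Fin 4) (x : ℍ[ℝ]) : Prop :=
  HasDensity volume (c ⁻¹' {k}) x 1

theorem ae_ne_zero : ∀ᵐ z : ℍ[ℝ], z ≠ 0 := by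
  rw [ae_iff]
  simp

/-- Pulled back along right multiplication by `g` and by `g'`, the class of `k` gives sets disjoint
off 0; density one of the first at `x` leaves density zero for the second. -/
theorem hasDensity_congr_right (hc : ∀ k, NullMeasurableSet (c ⁻¹' {k})) (k : Fin 4)
    {g g' : ℍ[ℝ]} (hg : g ≠ 0) (hg' : g' ≠ 0)
    (hgg : ∀ z ≠ 0, c (z * g) ≠ c (z * g')) {x : ℍ[ℝ]} (h : IsPure c k (x * g)) :
    HasDensity volume (c ⁻¹' {k}) (x * g') 0 := by
  rw [IsPure, hasDensity_mul_right _ hg] at h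
  rw [hasDensity_mul_right _ hg']
  have hm : NullMeasurableSet {z | z * g ∈ c ⁻¹' {k}} := by
    have hmeas : Measurable fun z : ℍ[ℝ] => z * g := (continuous_id.mul continuous_const).measurable
    have hq : Measure.QuasiMeasurePreserving (fun z : ℍ[ℝ] => z * g) volume volume :=
      ⟨hmeas, Measure.AbsolutelyContinuous.mk fun s hs h0 => by
        rw [Measure.map_apply hmeas hs]
        exact volume_preimage_mul_right hg h0⟩
    exact (hc k).preimage hq
  refine (h.compl hm).mono_zero ?_
  filter_upwards [ae_ne_zero] with z hz h1 h2
  exact hgg z hz ((show c (z * g) = k from h2).trans (show c (z * g') = k from h1).symm)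

theorem hasDensity_mul_invariant {w : ℍ[ℝ]} (hw : w ≠ 0) (hinv : ∀ z ≠ 0, c (z * w) = c z)
    (k : Fin 4) (x : ℍ[ℝ]) (l : ℝ≥0∞) :
    HasDensity volume (c ⁻¹' {k}) (x * w) l ↔ HasDensity volume (c ⁻¹' {k}) x l := by
  rw [hasDensity_mul_right _ hw]
  refine hasDensity_congr ?_
  rw [eventuallyEq_set]
  filter_upwards [ae_ne_zero] with z hz
  change c (z * w) = k ↔ c z = k
  rw [hinv z hz]

theorem ae_exists_isPure (hc : ∀ k, NullMeasurableSet (c ⁻¹' {k})) :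
    ∀ᵐ x, ∃ k, IsPure c k x := by
  have h : ∀ k, ∀ᵐ x, c x = k → IsPure c k x := by
    intro k
    obtain ⟨t, hsub, ht, hte⟩ := (hc k).exists_measurable_superset_ae_eq
    filter_upwards [ae_mem_imp_ballRatio_tendsto_one volume ht] with x hx hk
    exact (hasDensity_congr hte).1 (hx.1 (hsub hk))
  filter_upwards [ae_all_iff.2 h] with x hx
  exact ⟨c x, hx _ rfl⟩

/-- A class of positive measure cannot be conull, as right multiplication by `g` moves it off
itself. A segment between density points of the class and of its complement then yields a point
where neither has density zero, which rules out purity in every colour. -/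
theorem exists_ne_zero_forall_not_isPure (hc : ∀ k, NullMeasurableSet (c ⁻¹' {k})) {g : ℍ[ℝ]}
    (hg : g ≠ 0) (hcg : ∀ z ≠ 0, c z ≠ c (z * g)) : ∃ x ≠ 0, ∀ k, ¬ IsPure c k x := by
  obtain ⟨k, hk⟩ : ∃ k, volume (c ⁻¹' {k}) ≠ 0 := by
    by_contra! h
    have h1 : volume (⋃ k, c ⁻¹' {k}) = 0 := measure_iUnion_null h
    have h2 : (⋃ k, c ⁻¹' {k}) = univ := by
      ext x
      simp
    rw [h2] at h1
    exact isOpen_univ.measure_ne_zero (volume : Measure ℍ[ℝ]) univ_nonempty h1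
  obtain ⟨s, -, hs, hse⟩ := (hc k).exists_measurable_superset_ae_eq
  have hs0 : volume s ≠ 0 := by rwa [measure_congr hse]
  have hsc0 : volume sᶜ ≠ 0 := by
    intro h0
    have h1 : volume (c ⁻¹' {k})ᶜ = 0 := by rwa [measure_congr hse.symm.compl]
    have h2 := volume_preimage_mul_right hg h1
    refine hk (measure_mono_null (t := {x | x * g ∈ (c ⁻¹' {k})ᶜ} ∪ {0}) ?_
      (measure_union_null h2 (measure_singleton _)))
    intro z hz
    by_cases h : z = 0
    · exact Or.inr h
    · exact Or.inl fun h3 => hcg z h ((show c z = k from hz).trans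
        (show c (z * g) = k from h3).symm)
  have hae := ae_mem_imp_ballRatio_tendsto_one volume hs
  obtain ⟨a, ⟨ha, ha2⟩, ha0⟩ :=
    (((frequently_ae_mem_iff.2 hs0).and_eventually hae).and_eventually ae_ne_zero).exists
  -- Taking `b` off the line through `a` keeps the segment away from 0.
  have hline : ∀ᵐ z : ℍ[ℝ], z ∉ (ℝ ∙ a) := by
    rw [ae_iff]
    simp only [not_not]
    refine Measure.addHaar_submodule (volume : Measure ℍ[ℝ]) (ℝ ∙ a) fun htop => ?_
    have h1 := finrank_span_singleton (K := ℝ) ha0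
    rw [htop, finrank_top, Quaternion.finrank_eq_four] at h1
    norm_num at h1
  obtain ⟨b, ⟨hb, hb2⟩, hb0⟩ :=
    (((frequently_ae_mem_iff.2 hsc0).and_eventually hae).and_eventually hline).exists
  have hseg : segment ℝ a b ⊆ {0}ᶜ := by
    rintro _ ⟨u, v, hu, hv, huv, rfl⟩ h0
    have h0 : u • a + v • b = 0 := h0
    by_cases hv0 : v = 0
    · rw [hv0, add_zero] at huv
      rw [hv0, huv, zero_smul, add_zero, one_smul] at h0
      exact ha0 h0
    · refine hb0 (Submodule.mem_span_singleton.2 ⟨-(v⁻¹ * u), ?_⟩)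
      have : b = v⁻¹ • (v • b) := by rw [smul_smul, inv_mul_cancel₀ hv0, one_smul]
      rw [this, eq_neg_of_add_eq_zero_right h0, smul_neg, smul_smul, neg_smul]
  obtain ⟨x, hx0, hx1, hx2⟩ := exists_not_ballRatio_tendsto_zero volume hs
    isOpen_compl_singleton hseg (ha2.1 ha) (hb2.2 hb)
  refine ⟨x, hx0, fun l hl => ?_⟩
  have hx1' : ¬ HasDensity volume (c ⁻¹' {k}) x 0 := fun h => hx1 ((hasDensity_congr hse).2 h)
  have hx2' : ¬ HasDensity volume (c ⁻¹' {k})ᶜ x 0 := fun h =>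
    hx2 ((hasDensity_congr hse.compl).2 h)
  have hl' := HasDensity.compl (hc l) hl
  by_cases hkl : l = k
  · exact hx2' (hkl ▸ hl')
  · refine hx1' (hl'.mono_zero (Eventually.of_forall fun z hz h => ?_))
    exact hkl ((show c z = l from h).symm.trans hz)

theorem exists_two_colours (hc : ∀ k, NullMeasurableSet (c ⁻¹' {k})) {x : ℍ[ℝ]}
    (hx : ∀ k, ¬ IsPure c k x) : ∃ i j, i ≠ j ∧ ¬ HasDensity volume (c ⁻¹' {i}) x 0 ∧
      ¬ HasDensity volume (c ⁻¹' {j}) x 0 := by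
  by_contra! h
  obtain ⟨i, hi⟩ : ∃ i, ∀ j, j ≠ i → HasDensity volume (c ⁻¹' {j}) x 0 := by
    by_cases h0 : ∃ i, ¬ HasDensity volume (c ⁻¹' {i}) x 0
    · obtain ⟨i, hi⟩ := h0
      exact ⟨i, fun j hj => h i j hj.symm hi⟩
    · push Not at h0
      exact ⟨0, fun j _ => h0 j⟩
  have hunion : ∀ S : Finset (Fin 4), i ∉ S → HasDensity volume (c ⁻¹' (S : Set (Fin 4))) x 0 := by
    intro S
    induction S using Finset.induction_on with
    | empty =>
      intro _
      have : ballRatio volume (∅ : Set ℍ[ℝ]) x = fun _ => 0 := by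
        ext ρ
        simp [ballRatio]
      simp [HasDensity, this]
    | insert j S _ ih =>
      intro hj
      rw [Finset.mem_insert, not_or] at hj
      rw [Finset.coe_insert, insert_eq, preimage_union]
      exact (hi j (Ne.symm hj.1)).union_zero (ih hj.2)
  refine hx i (HasDensity.of_compl (hc i) ?_)
  have e : (c ⁻¹' {i})ᶜ = c ⁻¹' (({i}ᶜ : Finset (Fin 4)) : Set (Fin 4)) := by
    ext z
    simp
  rw [e]
  exact hunion _ (by simp)

/-- There is no measurable 4-colouring of the nonzero quaternions in which the members of a diamond
attached to a circle, and points at distance `b` along the outer circle, are coloured properly. -/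
theorem colouring_absurd (hc : ∀ k, NullMeasurableSet (c ⁻¹' {k}))
    (hinv : ∀ z ≠ 0, ∀ w : ℂ, w ≠ 0 → c (z * (w : ℍ[ℝ])) = c z)
    {a d : Fin 3 → ℂ} (ha : ∀ i, a i ≠ 0) (hd : ∀ i, d i ≠ 0)
    {g : Fin 3 → ℍ[ℝ]} (hg : ∀ i, g i = mkComplex (a i) (d i)) (hg1 : ∀ i, ‖g i‖ = 1)
    (h0 : ∀ z ≠ 0, c z ≠ c (z * g 0)) (h1 : ∀ z ≠ 0, c z ≠ c (z * g 1))
    (h01 : ∀ z ≠ 0, c (z * g 0) ≠ c (z * g 1)) (h02 : ∀ z ≠ 0, c (z * g 0) ≠ c (z * g 2))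
    (h12 : ∀ z ≠ 0, c (z * g 1) ≠ c (z * g 2)) {b : ℝ}
    (hrot : ∀ z ≠ 0, c (z * g 2) ≠ c (z * (expI b * g 2)))
    (hb : Irrational (b / Real.pi) ∨ ∃ q : ℕ, Odd q ∧ ∃ m : ℕ, q * b = m * Real.pi) : False := by
  have hgne : ∀ i, g i ≠ 0 := fun i => by
    rw [← norm_ne_zero_iff, hg1]
    exact one_ne_zero
  set M : Set ℍ[ℝ] := {x | ∀ k, ¬ IsPure c k x} with hM
  have hM0 : volume M = 0 := by
    have := ae_exists_isPure hc
    rw [ae_iff] at this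
    simpa only [not_exists] using this
  have hMinv : ∀ p ∈ M, ∀ w : ℂ, w ≠ 0 → p * (w : ℍ[ℝ]) ∈ M := by
    intro p hp w hw k hk
    exact hp k ((hasDensity_mul_invariant (coeComplex_ne_zero hw)
      (fun z hz => hinv z hz w hw) k p 1).1 hk)
  obtain ⟨q, hq0, hqM, hq⟩ : ∃ q ≠ 0, q ∈ M ∧ ∀ i, ∀ᵐ t : ℝ, q * expI t * g i ∉ M := by
    by_contra! hbad
    obtain ⟨q₀, hq₀, hq₀M⟩ := exists_ne_zero_forall_not_isPure hc (hgne 0) h0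
    obtain ⟨i, hi⟩ := hbad q₀ hq₀ hq₀M
    have hstep : ∀ᵐ s : ℝ, ∀ j, ∀ᵐ t : ℝ, q₀ * expI s * g i * expI t * g j ∉ M := by
      refine ae_all_iff.2 fun j => ?_
      have := ae_ae_mul_expI_notMem hM0 hMinv hq₀ (ha i) (hd i) (ha j) (hd j)
        (by rw [← hg, hg1]) (by rw [← hg, hg1])
      simpa only [← hg] using this
    -- The bad circle has impure points for a non-null set of `s`, while the second step is good for
    -- almost every `s`; a common `s` gives a good impure pole.
    obtain ⟨s, hs1, hs2⟩ := ((not_eventually.1 hi).and_eventually hstep).exists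
    obtain ⟨j, hj⟩ := hbad (q₀ * expI s * g i)
      (mul_ne_zero (mul_ne_zero hq₀ (expI_ne_zero s)) (hgne i)) (not_not.1 hs1)
    exact hj (hs2 j)
  obtain ⟨i, j, hij, hi, hj⟩ := exists_two_colours hc hqM
  have hexp : ∀ t k l, HasDensity volume (c ⁻¹' {k}) (q * expI t) l ↔
      HasDensity volume (c ⁻¹' {k}) q l := fun t k l =>
    hasDensity_mul_invariant (expI_ne_zero t)
      (fun z hz => hinv z hz _ (Complex.exp_ne_zero _)) k q l
  have hcol : ∀ᵐ t : ℝ, IsPure c i (q * expI t * g 2) ∨ IsPure c j (q * expI t * g 2) := by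
    filter_upwards [hq 0, hq 1, hq 2] with t ht0 ht1 ht2
    simp only [hM, mem_ofPred_eq, not_forall, not_not] at ht0 ht1 ht2
    obtain ⟨k₀, hk₀⟩ := ht0
    obtain ⟨k₁, hk₁⟩ := ht1
    obtain ⟨k₂, hk₂⟩ := ht2
    have hout : ∀ m : Fin 3, (∀ z ≠ 0, c z ≠ c (z * g m)) → ∀ k, IsPure c k (q * expI t * g m) →
        k ≠ i ∧ k ≠ j := by
      intro m hm k hk
      have h := hasDensity_congr_right hc k (hgne m) one_ne_zero
        (fun z hz => by rw [mul_one]; exact (hm z hz).symm) hk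
      rw [mul_one, hexp] at h
      exact ⟨fun e => hi (e ▸ h), fun e => hj (e ▸ h)⟩
    have hne : ∀ m m' : Fin 3, (∀ z ≠ 0, c (z * g m) ≠ c (z * g m')) → ∀ k k',
        IsPure c k (q * expI t * g m) → IsPure c k' (q * expI t * g m') → k ≠ k' := by
      intro m m' hm k k' hk hk' e
      subst e
      exact hk'.not_zero (hasDensity_congr_right hc k (hgne m) (hgne m') hm hk)
    have e0 := hout 0 h0 k₀ hk₀
    have e1 := hout 1 h1 k₁ hk₁
    have e01 := hne 0 1 h01 k₀ k₁ hk₀ hk₁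
    have e02 := hne 0 2 h02 k₀ k₂ hk₀ hk₂
    have e12 := hne 1 2 h12 k₁ k₂ hk₁ hk₂
    -- Of four colours, `k₀` and `k₁` use up the two other than `i, j`, and `k₂` differs from both.
    have : k₂ = i ∨ k₂ = j := by omega
    rcases this with rfl | rfl
    · exact Or.inl hk₂
    · exact Or.inr hk₂
  obtain ⟨s, -, hs, hse⟩ := (hc i).exists_measurable_superset_ae_eq
  -- A manifestly measurable set that contains the parameters pure in `i` and none pure in `j`.
  set A : Set ℝ := {t | ∃ N : ℕ, ∀ n ≥ N,
    1 / 2 < ballRatio volume (c ⁻¹' {i}) (q * expI t * g 2) (1 / ((n : ℝ) + 1))} with hA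
  have hlim : Tendsto (fun n : ℕ => 1 / ((n : ℝ) + 1)) atTop (𝓝[>] 0) :=
    tendsto_nhdsWithin_iff.2 ⟨tendsto_one_div_add_atTop_nhds_zero_nat,
      Eventually.of_forall fun n => by
        simp only [mem_Ioi]
        positivity⟩
  have hAi : ∀ t, IsPure c i (q * expI t * g 2) → t ∈ A := by
    intro t ht
    exact eventually_atTop.1 ((ht.comp hlim).eventually_const_lt (by simp))
  have hAj : ∀ t, IsPure c j (q * expI t * g 2) → t ∉ A := by
    rintro t ht hmem
    have h := (HasDensity.compl (hc j) ht).mono_zero (s := c ⁻¹' {i})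
      (Eventually.of_forall fun z hz h => hij ((show c z = i from hz).symm.trans h))
    obtain ⟨n, hn1, hn2⟩ := ((eventually_atTop.2 hmem).and
      ((h.comp hlim).eventually_lt_const (show (0 : ℝ≥0∞) < 1 / 2 by simp))).exists
    exact lt_asymm hn1 hn2
  have hAm : MeasurableSet A := by
    have hcont : Continuous fun t => q * expI t * g 2 :=
      (continuous_const.mul continuous_expI).mul continuous_const
    have hmeas : ∀ n : ℕ, MeasurableSet {t : ℝ | 1 / 2 <
        ballRatio volume (c ⁻¹' {i}) (q * expI t * g 2) (1 / ((n : ℝ) + 1))} := by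
      intro n
      refine measurableSet_lt measurable_const ?_
      have : (fun t => ballRatio volume (c ⁻¹' {i}) (q * expI t * g 2) (1 / ((n : ℝ) + 1))) =
          fun t => volume (s ∩ closedBall (q * expI t * g 2) (1 / ((n : ℝ) + 1))) /
            volume (closedBall (0 : ℍ[ℝ]) (1 / ((n : ℝ) + 1))) := by
        ext t
        rw [ballRatio, Measure.addHaar_closedBall_center,
          measure_congr (hse.symm.inter (ae_eq_refl (closedBall _ _)))]
      rw [this]
      exact ((continuous_measure_inter_closedBall volume hs _).comp hcont).measurable.div_const _
    have : A = ⋃ N : ℕ, ⋂ n : ℕ, ⋂ _ : n ≥ N, {t : ℝ | 1 / 2 <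
        ballRatio volume (c ⁻¹' {i}) (q * expI t * g 2) (1 / ((n : ℝ) + 1))} := by
      ext t
      simp [hA]
    rw [this]
    exact MeasurableSet.iUnion fun N => MeasurableSet.iInter fun n =>
      MeasurableSet.iInter fun _ => hmeas n
  -- The period is `π`, not `2π`: `expI π = -1`, and `c` is invariant under `-1`.
  have hper : ∀ t, t + Real.pi ∈ A ↔ t ∈ A := by
    have hneg : ∀ x ρ, ballRatio volume (c ⁻¹' {i}) (-x) ρ = ballRatio volume (c ⁻¹' {i}) x ρ := by
      intro x ρ
      have h := ballRatio_mul_right (c ⁻¹' {i}) (g := -1) (by simp) x ρ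
      rw [mul_neg_one, norm_neg, norm_one, mul_one] at h
      rw [h, ballRatio, ballRatio]
      congr 1
      refine measure_congr (EventuallyEq.inter ?_ (ae_eq_refl _))
      rw [eventuallyEq_set]
      filter_upwards [ae_ne_zero] with z hz
      change c (z * -1) = i ↔ c z = i
      have := hinv z hz (-1) (by simp)
      have e : (((-1 : ℂ)) : ℍ[ℝ]) = -1 := by ext <;> simp
      rw [e] at this
      rw [this]
    intro t
    have hpi : expI Real.pi = -1 := by
      rw [expI, Complex.exp_pi_mul_I]
      ext <;> simp
    simp only [hA, mem_ofPred_eq, expI_add, hpi, mul_neg, mul_one, neg_mul, hneg]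
  have hflip : ∀ᵐ t, (t + b ∈ A ↔ t ∉ A) := by
    have h2 := (measurePreserving_add_right (volume : Measure ℝ) b).quasiMeasurePreserving.ae hcol
    have hne : ∀ t k, IsPure c k (q * expI t * g 2) → ¬ IsPure c k (q * expI (t + b) * g 2) := by
      intro t k hk hk'
      have h := hasDensity_congr_right hc k (hgne 2) (mul_ne_zero (expI_ne_zero b) (hgne 2))
        hrot hk
      rw [expI_add, ← mul_assoc, mul_assoc] at hk'
      exact hk'.not_zero h
    filter_upwards [hcol, h2] with t ht ht2
    rcases ht with ht | ht <;> rcases ht2 with ht2 | ht2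
    · exact absurd ht2 (hne t i ht)
    · exact iff_of_false (hAj _ ht2) (not_not.2 (hAi _ ht))
    · exact iff_of_true (hAi _ ht2) (hAj _ ht)
    · exact absurd ht2 (hne t j ht)
  exact not_ae_flip hAm Real.pi_pos hper hflip hb

end Colouring

/-! ### Quaternions acting as rotations -/

/-- The pure quaternion with the coordinates of a vector. -/
def ofVec : E3 →ₗ[ℝ] ℍ[ℝ] where
  toFun v := mkComplex ⟨0, v 0⟩ ⟨v 1, v 2⟩
  map_add' v w := by ext <;> simp
  map_smul' t v := by ext <;> simp

/-- The vector part of a quaternion. -/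
def toVec : ℍ[ℝ] →ₗ[ℝ] E3 where
  toFun q := !₂[q.imI, q.imJ, q.imK]
  map_add' p q := by ext i; fin_cases i <;> simp
  map_smul' t q := by ext i; fin_cases i <;> simp

@[simp] theorem re_ofVec (v : E3) : (ofVec v).re = 0 := rfl

@[simp] theorem imI_ofVec (v : E3) : (ofVec v).imI = v 0 := rfl

@[simp] theorem imJ_ofVec (v : E3) : (ofVec v).imJ = v 1 := rfl

@[simp] theorem imK_ofVec (v : E3) : (ofVec v).imK = v 2 := rfl

theorem ofVec_injective : Function.Injective ofVec := by
  intro v w h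
  have h1 := congrArg QuaternionAlgebra.imI h
  have h2 := congrArg QuaternionAlgebra.imJ h
  have h3 := congrArg QuaternionAlgebra.imK h
  ext i
  fin_cases i
  exacts [h1, h2, h3]

theorem ofVec_toVec {q : ℍ[ℝ]} (hq : q.re = 0) : ofVec (toVec q) = q := by
  ext
  · exact hq.symm
  all_goals simp [toVec]

theorem norm_ofVec_sq (v : E3) : ‖ofVec v‖ ^ 2 = v 0 ^ 2 + v 1 ^ 2 + v 2 ^ 2 := by
  rw [sq, ← normSq_eq_norm_mul_self, normSq_def']
  simp

theorem norm_ofVec (v : E3) : ‖ofVec v‖ = ‖v‖ := by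
  rw [← sq_eq_sq₀ (norm_nonneg _) (norm_nonneg _), norm_ofVec_sq, EuclideanSpace.norm_sq_eq,
    Fin.sum_univ_three]
  simp

/-- The rotation `v ↦ q v q⁻¹` of three-space. -/
def rot (q : ℍ[ℝ]) : E3 →ₗ[ℝ] E3 :=
  toVec ∘ₗ LinearMap.mulRight ℝ q⁻¹ ∘ₗ LinearMap.mulLeft ℝ q ∘ₗ ofVec

theorem rot_apply (q : ℍ[ℝ]) (v : E3) : rot q v = toVec (q * ofVec v * q⁻¹) := rfl

theorem ofVec_rot (q : ℍ[ℝ]) (v : E3) : ofVec (rot q v) = q * ofVec v * q⁻¹ := by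
  rw [rot_apply, ofVec_toVec]
  rw [instInv]
  simp
  exact Or.inr (by ring)

theorem norm_rot {q : ℍ[ℝ]} (hq : q ≠ 0) (v : E3) : ‖rot q v‖ = ‖v‖ := by
  rw [← norm_ofVec, ofVec_rot, norm_mul, norm_mul, norm_inv, norm_ofVec]
  have := norm_ne_zero_iff.2 hq
  field_simp

theorem dist_rot {q : ℍ[ℝ]} (hq : q ≠ 0) (v w : E3) : dist (rot q v) (rot q w) = dist v w := by
  rw [dist_eq_norm, ← map_sub, norm_rot hq, dist_eq_norm]

theorem rot_mul (p q : ℍ[ℝ]) (v : E3) : rot (p * q) v = rot p (rot q v) := by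
  apply ofVec_injective
  simp only [ofVec_rot, mul_inv_rev, mul_assoc]

theorem rot_one (v : E3) : rot 1 v = v := by
  apply ofVec_injective
  simp [ofVec_rot]

theorem rot_eq_of_mul_eq {q : ℍ[ℝ]} (hq : q ≠ 0) {v w : E3} (h : q * ofVec v = ofVec w * q) :
    rot q v = w := by
  apply ofVec_injective
  rw [ofVec_rot, h, mul_inv_cancel_right₀ hq]

/-- A nonzero quaternion acts on three-space by a linear equivalence. -/
def rotEquiv (q : ℍ[ℝ]) (hq : q ≠ 0) : E3 ≃ₗ[ℝ] E3 :=
  LinearEquiv.ofLinearMap (rot q) (rot q⁻¹)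
    (LinearMap.ext fun v => by simp [← rot_mul, mul_inv_cancel₀ hq, rot_one])
    (LinearMap.ext fun v => by simp [← rot_mul, inv_mul_cancel₀ hq, rot_one])

theorem measurable_rot : Measurable fun x : ℍ[ℝ] × E3 => rot x.1 x.2 := by
  have h1 : Continuous ofVec := ofVec.continuous_of_finiteDimensional
  have h2 : Continuous toVec := toVec.continuous_of_finiteDimensional
  have e : (fun x : ℍ[ℝ] × E3 => rot x.1 x.2) = fun x =>
      (normSq x.1)⁻¹ • toVec (x.1 * ofVec x.2 * star x.1) := by
    ext1 x
    rw [← map_smul, rot_apply, inv_def, mul_smul_comm]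
  rw [e]
  refine Measurable.smul (f := fun x : ℍ[ℝ] × E3 => (normSq x.1)⁻¹) ?_ ?_
  · have : Continuous fun x : ℍ[ℝ] × E3 => normSq x.1 := continuous_normSq.comp continuous_fst
    exact this.measurable.inv
  · have : Continuous fun x : ℍ[ℝ] × E3 => toVec (x.1 * ofVec x.2 * star x.1) :=
      h2.comp ((continuous_fst.mul (h1.comp continuous_snd)).mul continuous_fst.star)
    exact this.measurable

/-- The unit vector of the first axis, which corresponds to the quaternion `i`. -/
def axis : E3 := EuclideanSpace.single 0 1

theorem norm_axis : ‖axis‖ = 1 := by simp [axis]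

theorem ofVec_axis : ofVec axis = mkComplex Complex.I 0 := by
  ext <;> simp [axis]

theorem rot_coe_axis {w : ℂ} (hw : w ≠ 0) : rot (w : ℍ[ℝ]) axis = axis := by
  refine rot_eq_of_mul_eq (coeComplex_ne_zero hw) ?_
  rw [ofVec_axis, coe_mul_mkComplex, mkComplex_mul_coe, mul_comm]
  simp

theorem rot_mkComplex_zero_axis {w : ℂ} (hw : w ≠ 0) : rot (mkComplex 0 w) axis = -axis := by
  refine rot_eq_of_mul_eq ?_ ?_
  · rw [← norm_ne_zero_iff, ← sq_pos_iff, norm_mkComplex_sq, norm_zero, zero_pow two_ne_zero,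
      zero_add, sq_pos_iff]
    exact norm_ne_zero_iff.2 hw
  · rw [map_neg, neg_mul, ofVec_axis, mkComplex_mul_mkComplex, mkComplex_mul_mkComplex]
    ext <;> simp

theorem exists_rot_axis_eq {v : E3} (hv : ‖v‖ = 1) : ∃ g : ℍ[ℝ], ‖g‖ = 1 ∧ rot g axis = v := by
  suffices h : ∃ g : ℍ[ℝ], g ≠ 0 ∧ g * ofVec axis = ofVec v * g by
    obtain ⟨g, hg, h⟩ := h
    have hn := norm_ne_zero_iff.2 hg
    refine ⟨‖g‖⁻¹ • g, ?_, ?_⟩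
    · rw [norm_smul, norm_inv, norm_norm, inv_mul_cancel₀ hn]
    · refine rot_eq_of_mul_eq (smul_ne_zero (inv_ne_zero hn) hg) ?_
      rw [smul_mul_assoc, mul_smul_comm, h]
  have hsq : ∀ u : E3, ‖u‖ = 1 → ofVec u * ofVec u = -1 := by
    intro u hu
    have h1 := norm_ofVec_sq u
    rw [norm_ofVec, hu] at h1
    ext
    · simp
      linarith
    all_goals simp
    all_goals ring
  by_cases hva : v = -axis
  · refine ⟨mkComplex 0 1, fun h => ?_, ?_⟩
    · have := congrArg QuaternionAlgebra.imJ h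
      simp at this
    · rw [hva, map_neg, ofVec_axis]
      ext <;> simp
  -- With `i` and `v` both squaring to `-1`, `(1 - v i) i = i + v = v (1 - v i)`. This element
  -- vanishes only at `v = -i`, where `j` serves.
  · refine ⟨1 - ofVec v * ofVec axis, fun h => hva ?_, ?_⟩
    · apply ofVec_injective
      have h1 : ofVec v * ofVec axis = 1 := (sub_eq_zero.1 h).symm
      have h2 : ofVec v * ofVec axis * ofVec axis = -ofVec v := by
        rw [mul_assoc, hsq _ norm_axis, mul_neg_one]
      rw [h1, one_mul] at h2
      rw [map_neg, h2, neg_neg]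
    · rw [sub_mul, mul_sub, mul_assoc, hsq _ norm_axis, ← mul_assoc, hsq _ hv]
      simp [add_comm]

/-- A quaternion `z` fixes the axis and `w j` reverses it, so a vanishing coordinate would put the
image at a pole. -/
theorem coordinates_ne_zero {g : ℍ[ℝ]} (hg : g ≠ 0) (h1 : rot g axis ≠ axis)
    (h2 : rot g axis ≠ -axis) :
    ∃ a d : ℂ, a ≠ 0 ∧ d ≠ 0 ∧ g = mkComplex a d := by
  have e : g = mkComplex ⟨g.re, g.imI⟩ ⟨g.imJ, g.imK⟩ := rfl
  refine ⟨_, _, fun h => ?_, fun h => ?_, e⟩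
  · rw [h] at e
    rw [e] at hg h2
    refine h2 (rot_mkComplex_zero_axis fun h0 => hg ?_)
    rw [h0]
    ext <;> simp
  · rw [h] at e
    have e' : ∀ z : ℂ, mkComplex z 0 = (z : ℍ[ℝ]) := fun z => by ext <;> simp
    rw [e, e'] at hg h1
    refine h1 (rot_coe_axis fun h0 => hg ?_)
    rw [h0]
    ext <;> simp

/-- Conjugation by `expI b` rotates by the angle `2b`, so the chord is `2 |sin b|` times the
distance of `v` from the axis. -/
theorem dist_rot_expI_sq (b : ℝ) (v : E3) :
    dist v (rot (expI b) v) ^ 2 = 4 * Real.sin b ^ 2 * (‖v‖ ^ 2 - v 0 ^ 2) := by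
  have h1 : dist v (rot (expI b) v) = ‖expI b * ofVec v - ofVec v * expI b‖ := by
    rw [dist_comm, dist_eq_norm, ← norm_ofVec, map_sub, ofVec_rot]
    have : expI b * ofVec v * (expI b)⁻¹ - ofVec v =
        (expI b * ofVec v - ofVec v * expI b) * (expI b)⁻¹ := by
      rw [sub_mul, mul_inv_cancel_right₀ (expI_ne_zero b)]
    rw [this, norm_mul, norm_inv, norm_expI, inv_one, mul_one]
  have h2 : (expI b).re = Real.cos b ∧ (expI b).imI = Real.sin b ∧ (expI b).imJ = 0 ∧
      (expI b).imK = 0 := by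
    simp [expI, Complex.exp_ofReal_mul_I_re, Complex.exp_ofReal_mul_I_im]
  obtain ⟨e0, e1, e2, e3⟩ := h2
  rw [h1, ← norm_ofVec, norm_ofVec_sq, sq, ← normSq_eq_norm_mul_self, normSq_def']
  simp [e0, e1, e2, e3]
  ring

end Quaternion

/-! ### Null sets of the sphere and of the quaternions -/

theorem volume_cone_eq_zero {r : ℝ} (hr : 0 < r) {N : Set (S2 r)} (hN : surfaceMeasure r N = 0) :
    volume {v : E3 | 0 < ‖v‖ ∧ ‖v‖ < 1 ∧ (r / ‖v‖) • v ∈ ((↑) '' N : Set E3)} = 0 := by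
  rw [surfaceMeasure, comap_subtype_coe_apply isClosed_sphere.measurableSet,
    ambientSurfaceMeasure, Measure.smul_apply, smul_eq_mul, mul_eq_zero] at hN
  have hr2 : ENNReal.ofReal (r ^ 2) ≠ 0 := by simp [hr.ne']
  have h1 := hN.resolve_left hr2
  have hm : Measurable fun u : sphere (0 : E3) 1 => r • (u : E3) := by fun_prop
  have h2 := Measure.preimage_null_of_map_null hm.aemeasurable h1
  set M := toMeasurable (volume : Measure E3).toSphere
    ((fun u : sphere (0 : E3) 1 => r • (u : E3)) ⁻¹' ((↑) '' N)) with hM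
  have h3 : (volume : Measure E3).toSphere M = 0 := by rw [hM, measure_toMeasurable, h2]
  rw [Measure.toSphere_apply' _ (measurableSet_toMeasurable _ _), mul_eq_zero] at h3
  refine measure_mono_null ?_ (h3.resolve_left (by simp))
  rintro v ⟨hv0, hv1, hv⟩
  have hu : ‖v‖⁻¹ • v ∈ sphere (0 : E3) 1 := by
    rw [mem_sphere_zero_iff_norm, norm_smul, norm_inv, norm_norm, inv_mul_cancel₀ hv0.ne']
  refine ⟨‖v‖, ⟨hv0, hv1⟩, ‖v‖⁻¹ • v, ⟨⟨_, hu⟩, subset_toMeasurable _ _ ?_, rfl⟩, ?_⟩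
  · change r • ‖v‖⁻¹ • v ∈ ((↑) '' N : Set E3)
    rwa [smul_smul, ← div_eq_mul_inv]
  · change ‖v‖ • ‖v‖⁻¹ • v = v
    rw [smul_smul, mul_inv_cancel₀ hv0.ne', one_smul]

namespace Quaternion

/-- Fubini on pairs `(q, v)`: each nonzero `q` acts linearly and preserves nullness of the cone over
`N`, so some `v` in the punctured unit ball avoids the cone under almost every `q`. A right
translation carries the direction of `v` to the axis. -/
theorem ae_rot_axis_notMem {r : ℝ} (hr : 0 < r) {N : Set (S2 r)} (hN : surfaceMeasure r N = 0) :
    ∀ᵐ q : ℍ[ℝ], rot q (r • axis) ∉ ((↑) '' N : Set E3) := by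
  set C := toMeasurable volume
    {v : E3 | 0 < ‖v‖ ∧ ‖v‖ < 1 ∧ (r / ‖v‖) • v ∈ ((↑) '' N : Set E3)} with hC
  have hC0 : volume C = 0 := by rw [hC, measure_toMeasurable, volume_cone_eq_zero hr hN]
  have hm : MeasurableSet {x : ℍ[ℝ] × E3 | rot x.1 x.2 ∉ C} :=
    measurable_rot (measurableSet_toMeasurable _ _).compl
  have h1 : ∀ᵐ v : E3, ∀ᵐ q : ℍ[ℝ], rot q v ∉ C := by
    refine (Measure.ae_ae_comm (μ := (volume : Measure ℍ[ℝ])) (ν := (volume : Measure E3))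
      (p := fun q v => rot q v ∉ C) hm).1 ?_
    filter_upwards [ae_ne_zero] with q hq
    rw [ae_iff]
    simp only [not_not]
    exact measure_preimage_linearEquiv_null volume volume (rotEquiv q hq) hC0
  obtain ⟨v, ⟨hv1, hv0⟩, hv⟩ : ∃ v ∈ ball (0 : E3) 1 ∩ {0}ᶜ, ∀ᵐ q : ℍ[ℝ], rot q v ∉ C := by
    have hne : (volume : Measure E3) (ball (0 : E3) 1 ∩ {0}ᶜ) ≠ 0 := by
      refine (isOpen_ball.inter isOpen_compl_singleton).measure_ne_zero _
        ⟨EuclideanSpace.single 0 (1 / 2), ?_, ?_⟩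
      · rw [mem_ball_zero_iff]
        simp
        norm_num
      · simp
    obtain ⟨v, h⟩ := ((frequently_ae_mem_iff.2 hne).and_eventually h1).exists
    exact ⟨v, h⟩
  have hv0 : ‖v‖ ≠ 0 := norm_ne_zero_iff.2 hv0
  rw [mem_ball_zero_iff] at hv1
  obtain ⟨p, hp1, hp⟩ := exists_rot_axis_eq (v := ‖v‖⁻¹ • v)
    (by rw [norm_smul, norm_inv, norm_norm, inv_mul_cancel₀ hv0])
  have hp0 : p ≠ 0 := norm_ne_zero_iff.1 (by rw [hp1]; exact one_ne_zero)
  have h2 : ∀ᵐ q : ℍ[ℝ], rot (q * p) (r • axis) ∉ ((↑) '' N : Set E3) := by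
    filter_upwards [hv, ae_ne_zero] with q hq hq0 hmem
    refine hq (subset_toMeasurable _ _ ⟨?_, ?_, ?_⟩)
    · rw [norm_rot hq0]
      positivity
    · rwa [norm_rot hq0]
    · rw [rot_mul, map_smul (rot p), hp, smul_smul, ← div_eq_mul_inv, map_smul] at hmem
      rwa [norm_rot hq0]
  rw [ae_iff] at h2 ⊢
  refine measure_mono_null (fun q hq => ?_) (volume_preimage_mul_right (inv_ne_zero hp0) h2)
  change ¬ rot (q * p⁻¹ * p) (r • axis) ∉ ((↑) '' N : Set E3)
  rw [inv_mul_cancel_right₀ hp0]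
  exact hq

/-- The image of the point `r • axis` of the sphere under the rotation by `q`, with the
value `x` at `q = 0`. -/
def spherePoint {r : ℝ} (x : S2 r) (q : ℍ[ℝ]) : S2 r :=
  open Classical in
  if h : ‖rot q (r • axis)‖ = r then ⟨rot q (r • axis), mem_sphere_zero_iff_norm.2 h⟩ else x

theorem coe_spherePoint {r : ℝ} (hr : 0 < r) (x : S2 r) {q : ℍ[ℝ]} (hq : q ≠ 0) :
    (spherePoint x q : E3) = rot q (r • axis) := by
  have : ‖rot q (r • axis)‖ = r := by
    rw [norm_rot hq, norm_smul, norm_axis, mul_one, Real.norm_of_nonneg hr.le]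
  rw [spherePoint, dif_pos this]

theorem quasiMeasurePreserving_spherePoint {r : ℝ} (hr : 0 < r) (x : S2 r) :
    Measure.QuasiMeasurePreserving (spherePoint x) volume (surfaceMeasure r) := by
  have hrot : Measurable fun q => rot q (r • axis) :=
    Measurable.comp (g := fun y : ℍ[ℝ] × E3 => rot y.1 y.2) (f := fun q => (q, r • axis))
      measurable_rot (measurable_id.prodMk measurable_const)
  have hm : Measurable (spherePoint x) := by
    classical
    have : (fun q => (spherePoint x q : E3)) =
        fun q => if ‖rot q (r • axis)‖ = r then rot q (r • axis) else x := by
      ext1 q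
      by_cases h : ‖rot q (r • axis)‖ = r
      · rw [spherePoint, dif_pos h, if_pos h]
      · rw [spherePoint, dif_neg h, if_neg h]
    refine (MeasurableEmbedding.subtype_coe isClosed_sphere.measurableSet).measurable_comp_iff.1 ?_
    change Measurable fun q => (spherePoint x q : E3)
    rw [this]
    exact Measurable.ite (measurableSet_eq_fun hrot.norm measurable_const) hrot measurable_const
  refine ⟨hm, Measure.AbsolutelyContinuous.mk fun N hN h0 => ?_⟩
  rw [Measure.map_apply hm hN, measure_eq_zero_iff_ae_notMem]
  filter_upwards [ae_rot_axis_notMem hr h0, ae_ne_zero] with q hq hq0 hmem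
  exact hq ⟨_, hmem, coe_spherePoint hr x hq0⟩

end Quaternion

/-! ### Geometry of the traced circle and of the diamond -/

/-- The circle traced by `x` around the axis through `p` has the expected radius. -/
theorem IsCircleOfRadius.sq_eq {p x : E3} (hp : p ≠ 0) {D : ℝ}
    (h : IsCircleOfRadius (tracedSet p x) D) :
    D ^ 2 = ‖x‖ ^ 2 - inner ℝ p x ^ 2 / ‖p‖ ^ 2 := by
  obtain ⟨hD, c, n, -, hS⟩ := h
  have hp' : ‖p‖ ≠ 0 := norm_ne_zero_iff.2 hp
  set o : E3 := (inner ℝ p x / ‖p‖ ^ 2) • p with ho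
  have hsq : ‖x - o‖ ^ 2 = ‖x‖ ^ 2 - inner ℝ p x ^ 2 / ‖p‖ ^ 2 := by
    rw [norm_sub_sq_real, ho, inner_smul_right, norm_smul, mul_pow, real_inner_comm x p,
      Real.norm_eq_abs, sq_abs]
    field_simp
    ring
  have hdist : ∀ y ∈ tracedSet p x, dist y o = dist x o := by
    rintro y ⟨ρ, ⟨hρ, -⟩, rfl⟩
    have : ρ o = o := by rw [ho, map_smul, hρ]
    nth_rw 1 [← this]
    exact ρ.dist_map x o
  have hx : x ∈ tracedSet p x := ⟨LinearIsometryEquiv.refl ℝ E3, ⟨rfl, LinearMap.det_id⟩, rfl⟩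
  -- The half-turn about `p` sends `x` to its antipode about the foot `o` of the perpendicular.
  -- Comparing the diameters through `o` and through `c` gives both inequalities between `D` and the
  -- distance to `o`, without identifying the centres.
  have hx' : (2 : ℝ) • o - x ∈ tracedSet p x := by
    refine ⟨(ℝ ∙ p).reflection, ⟨?_, ?_⟩, ?_⟩
    · exact Submodule.reflection_mem_subspace_eq_self (Submodule.mem_span_singleton_self p)
    · have h1 := Submodule.det_reflection (𝕜 := ℝ) (ℝ ∙ p)
      have : Fact (Module.finrank ℝ E3 = 2 + 1) := ⟨by simp⟩
      rw [Submodule.finrank_orthogonal_span_singleton (n := 2) hp] at h1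
      exact h1.trans (by norm_num)
    · rw [Submodule.reflection_singleton_apply, ho]
      simp [two_smul]
  have hx2 : (2 : ℝ) • c - x ∈ tracedSet p x := by
    have e : (2 : ℝ) • c - x - c = -(x - c) := by
      rw [two_smul]
      abel
    rw [hS] at hx ⊢
    refine ⟨?_, ?_⟩
    · rw [dist_eq_norm, e, norm_neg, ← dist_eq_norm]
      exact hx.1
    · rw [e, inner_neg_right, hx.2, neg_zero]
  have hdouble : ∀ w : E3, dist x ((2 : ℝ) • w - x) = 2 * dist x w := by
    intro w
    rw [dist_eq_norm, dist_eq_norm]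
    have : x - ((2 : ℝ) • w - x) = (2 : ℝ) • (x - w) := by
      rw [smul_sub, two_smul, two_smul]
      abel
    rw [this, norm_smul, Real.norm_two]
  have hle : dist x o ≤ D := by
    have h1 := hdouble o
    have h2 := dist_triangle_right x ((2 : ℝ) • o - x) c
    rw [hS] at hx hx'
    have h3 := hx.1
    have h4 := hx'.1
    linarith
  have hge : D ≤ dist x o := by
    have h1 := hdouble c
    have h2 := dist_triangle_right x ((2 : ℝ) • c - x) o
    rw [hdist _ hx2] at h2
    rw [hS] at hx
    have h3 := hx.1
    linarith
  rw [le_antisymm hge hle, dist_eq_norm, hsq]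

namespace Quaternion

/-- If `y` were antipodal to the pole then `2r = 1`, and `z` would be at distance one from both ends
of a diameter of length one; the parallelogram law would give `2 = 4r² = 1`. -/
theorem rot_axis_ne_of_one_eq_dist {r : ℝ} (hr : 0 < r) {y z : E3} (hz : ‖z‖ = r)
    (h1 : dist (r • axis) y = 1) (h2 : dist (r • axis) z = 1) (h3 : dist y z = 1) :
    y ≠ r • axis ∧ y ≠ -(r • axis) := by
  have hn : ‖r • axis‖ = r := by rw [norm_smul, norm_axis, mul_one, Real.norm_of_nonneg hr.le]
  refine ⟨fun h => ?_, fun h => ?_⟩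
  · rw [h, dist_self] at h1
    exact zero_ne_one h1
  · have hr2 : 2 * r = 1 := by
      rw [h, dist_eq_norm, sub_neg_eq_add, ← two_smul ℝ, norm_smul, hn, Real.norm_two] at h1
      exact h1
    have key := parallelogram_law_with_norm ℝ (r • axis) z
    rw [← dist_eq_norm, h2, hn, hz] at key
    have : ‖r • axis + z‖ = 1 := by
      rw [h, dist_eq_norm, ← norm_neg, neg_sub, sub_neg_eq_add, add_comm] at h3
      exact h3
    rw [this] at key
    nlinarith

end Quaternion

open Quaternion

/-! ### From the sphere to the quaternions and conclusion -/

theorem odd_multiple_half_angle {p q : ℕ} (hpq : Nat.Coprime p q) (hp : Even p) {β : ℝ}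
    (hq : 0 < q) (hβ : β = (p : ℝ) / q * Real.pi) :
    ∃ n : ℕ, Odd n ∧ ∃ m : ℕ, n * (β / 2) = m * Real.pi := by
  obtain ⟨m, rfl⟩ := hp
  refine ⟨q, ?_, m, ?_⟩
  · rw [← Nat.not_even_iff_odd]
    intro h
    have := Nat.dvd_gcd (even_iff_two_dvd.1 ⟨m, rfl⟩) (even_iff_two_dvd.1 h)
    rw [hpq.gcd_eq_one] at this
    omega
  · have : (q : ℝ) ≠ 0 := by positivity
    rw [hβ]
    push_cast
    field_simp
    ring

/-- The lift along `spherePoint x` turns the colouring into one excluded by `colouring_absurd`. The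
hypothesis on `b` says that rotation by `2b` about `x` moves `w` by distance one. -/
theorem not_measurablyColorable_of_le_four {r : ℝ} (hr : 0 < r) {x y z w : S2 r}
    (hxy : dist x y = 1) (hxz : dist x z = 1) (hyz : dist y z = 1) (hyw : dist y w = 1)
    (hzw : dist z w = 1) {b : ℝ}
    (hb : 4 * Real.sin b ^ 2 * (‖(w : E3)‖ ^ 2 - inner ℝ (x : E3) w ^ 2 / ‖(x : E3)‖ ^ 2) = 1)
    (hbπ : Irrational (b / Real.pi) ∨ ∃ q : ℕ, Odd q ∧ ∃ m : ℕ, q * b = m * Real.pi)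
    {k : ℕ} (hk : k ≤ 4) : ¬ MeasurablyColorable (S2 r) (surfaceMeasure r) k := by
  rintro ⟨φ, hφ⟩
  have hnorm : ∀ u : S2 r, ‖(u : E3)‖ = r := fun u => mem_sphere_zero_iff_norm.1 u.2
  have hrot : ∀ u : E3, ‖u‖ = r → ∃ g : ℍ[ℝ], ‖g‖ = 1 ∧ rot g (r • axis) = u := by
    intro u hu
    obtain ⟨g, hg1, hg⟩ := exists_rot_axis_eq (v := r⁻¹ • u)
      (by rw [norm_smul, hu, norm_inv, Real.norm_of_nonneg hr.le, inv_mul_cancel₀ hr.ne'])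
    exact ⟨g, hg1, by rw [map_smul, hg, smul_smul, mul_inv_cancel₀ hr.ne', one_smul]⟩
  have hunit : ∀ g : ℍ[ℝ], ‖g‖ = 1 → g ≠ 0 := fun g hg =>
    norm_ne_zero_iff.1 (by rw [hg]; exact one_ne_zero)
  obtain ⟨q₀, hq₀1, hq₀⟩ := hrot x (hnorm x)
  have hq₀0 := inv_ne_zero (hunit _ hq₀1)
  set ψ : S2 r → E3 := fun u => rot q₀⁻¹ u with hψ
  have hψx : ψ x = r • axis := by
    change rot q₀⁻¹ (x : E3) = _
    rw [← hq₀, ← rot_mul, inv_mul_cancel₀ (hunit _ hq₀1), rot_one]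
  have hψd : ∀ u v, dist (ψ u) (ψ v) = dist u v := fun u v => dist_rot hq₀0 _ _
  have hψn : ∀ u, ‖ψ u‖ = r := fun u => (norm_rot hq₀0 _).trans (hnorm u)
  set y' : Fin 3 → S2 r := ![y, z, w] with hy'
  choose g hg1 hg using fun i => hrot (ψ (y' i)) (hψn _)
  have hgne := fun i => hunit _ (hg1 i)
  have haxis : rot 1 (r • axis) = ψ x := by rw [rot_one, hψx]
  have hin : inner ℝ (x : E3) w = r * ψ w 0 := by
    have h1 := hψd x w
    have h2 : inner ℝ (x : E3) w = inner ℝ (ψ x) (ψ w) := by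
      rw [real_inner_eq_norm_mul_self_add_norm_mul_self_sub_norm_sub_mul_self_div_two,
        real_inner_eq_norm_mul_self_add_norm_mul_self_sub_norm_sub_mul_self_div_two,
        ← dist_eq_norm, ← dist_eq_norm, h1, hψn, hψn, hnorm, hnorm]
      rfl
    rw [h2, hψx, inner_smul_left, axis, EuclideanSpace.inner_single_left]
    simp
  have hD : 4 * Real.sin b ^ 2 * (‖ψ w‖ ^ 2 - ψ w 0 ^ 2) = 1 := by
    rw [hin, hnorm, hnorm] at hb
    rw [hψn, ← hb]
    field_simp
  have hcoord : ∀ i, ∃ a d : ℂ, a ≠ 0 ∧ d ≠ 0 ∧ g i = mkComplex a d := by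
    intro i
    have hi : ψ (y' i) ≠ r • axis ∧ ψ (y' i) ≠ -(r • axis) := by
      fin_cases i
      · exact rot_axis_ne_of_one_eq_dist hr (hψn _) (by rw [← hψx, hψd]; exact hxy)
          (by rw [← hψx, hψd]; exact hxz) ((hψd _ _).trans hyz)
      · exact rot_axis_ne_of_one_eq_dist hr (hψn _) (by rw [← hψx, hψd]; exact hxz)
          (by rw [← hψx, hψd]; exact hxy) ((hψd _ _).trans (dist_comm z y ▸ hyz))
      -- At a pole the traced circle would have radius zero, against `hD`.
      · change ψ w ≠ _ ∧ ψ w ≠ _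
        have h1 : ‖ψ w‖ = r := hψn w
        constructor <;> intro h <;> rw [h1, h] at hD <;> simp [axis] at hD
    refine coordinates_ne_zero (hgne i) (fun h => hi.1 ?_) (fun h => hi.2 ?_)
    · rw [← hg, map_smul, h]
    · rw [← hg, map_smul, h, smul_neg]
  choose a d ha hd had using hcoord
  set c : ℍ[ℝ] → Fin 4 := fun q => Fin.castLE hk (φ (spherePoint x q)) with hc
  have hne : ∀ u v : ℍ[ℝ], u ≠ 0 → v ≠ 0 → dist (rot u (r • axis)) (rot v (r • axis)) = 1 →
      ∀ q ≠ 0, c (q * u) ≠ c (q * v) := by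
    intro u v hu hv h q hq heq
    have hadj : (unitDistanceGraph (S2 r)).Adj (spherePoint x (q * u)) (spherePoint x (q * v)) := by
      change dist (spherePoint x (q * u) : E3) (spherePoint x (q * v)) = 1
      rw [coe_spherePoint hr x (mul_ne_zero hq hu), coe_spherePoint hr x (mul_ne_zero hq hv),
        rot_mul, rot_mul, dist_rot hq, h]
    exact φ.valid hadj (Fin.castLE_injective hk heq)
  have hne1 : ∀ i, dist x (y' i) = 1 → ∀ q ≠ 0, c q ≠ c (q * g i) := by
    intro i hi q hq
    have := hne 1 (g i) one_ne_zero (hgne i) (by rw [haxis, hg, hψd, hi]) q hq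
    rwa [mul_one] at this
  have hne2 : ∀ i j, dist (y' i) (y' j) = 1 → ∀ q ≠ 0, c (q * g i) ≠ c (q * g j) := fun i j hij =>
    hne _ _ (hgne i) (hgne j) (by rw [hg, hg, hψd, hij])
  refine colouring_absurd (c := c) (fun l => ?_) (fun q hq t ht => ?_) ha hd had hg1
    (hne1 0 hxy) (hne1 1 hxz) (hne2 0 1 hyz) (hne2 0 2 hyw) (hne2 1 2 hzw) (b := b)
    (hne _ _ (hgne 2) (mul_ne_zero (expI_ne_zero b) (hgne 2)) ?_) hbπ
  · by_cases hl : ∃ i : Fin k, Fin.castLE hk i = l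
    · obtain ⟨i, rfl⟩ := hl
      have : c ⁻¹' {Fin.castLE hk i} = spherePoint x ⁻¹' (φ ⁻¹' {i}) := by
        ext q
        exact (Fin.castLE_injective hk).eq_iff
      rw [this]
      exact (hφ i).preimage (quasiMeasurePreserving_spherePoint hr x)
    · have : c ⁻¹' {l} = ∅ := by
        ext q
        simp only [mem_preimage, mem_singleton_iff, mem_empty_iff_false, iff_false]
        exact fun h => hl ⟨_, h⟩
      rw [this]
      exact nullMeasurableSet_empty
  · have : spherePoint x (q * (t : ℍ[ℝ])) = spherePoint x q := by
      apply Subtype.ext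
      rw [coe_spherePoint hr x (mul_ne_zero hq (coeComplex_ne_zero ht)), coe_spherePoint hr x hq,
        rot_mul, map_smul (rot (t : ℍ[ℝ])), rot_coe_axis ht]
    simp only [hc, this]
  · rw [rot_mul, hg, ← sq_eq_sq₀ dist_nonneg zero_le_one, one_pow, dist_rot_expI_sq]
    exact hD

end

theorem theorem4p1 (r : ℝ) (x₁ x₂ x₃ x₄ : S2 r)
    (h12 : dist x₁ x₂ = 1) (h13 : dist x₁ x₃ = 1) (h23 : dist x₂ x₃ = 1)
    (h24 : dist x₂ x₄ = 1) (h34 : dist x₃ x₄ = 1) (h14 : x₁ ≠ x₄)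
    (D : ℝ) (hD : IsCircleOfRadius (tracedSet (x₁ : E3) (x₄ : E3)) D) (hD2 : 1 / 2 < D)
    (β : ℝ) (hβ : β = 2 * Real.arcsin (1 / (2 * D)))
    (hβπ : (∃ c : ℝ, Irrational c ∧ β = c * Real.pi) ∨
      (∃ p q : ℕ, 0 < q ∧ Nat.Coprime p q ∧ Even p ∧ β = (p : ℝ) / (q : ℝ) * Real.pi)) :
    5 ≤ measurableChromaticNumber (S2 r) (surfaceMeasure r) := by
  have hr0 : 0 ≤ r := (norm_nonneg _).trans_eq (mem_sphere_zero_iff_norm.1 x₁.2)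
  have hr : 0 < r := by
    refine hr0.lt_of_ne fun h => ?_
    subst h
    have h1 : x₁ = x₂ := by
      apply Subtype.ext
      rw [norm_eq_zero.1 (mem_sphere_zero_iff_norm.1 x₁.2),
        norm_eq_zero.1 (mem_sphere_zero_iff_norm.1 x₂.2)]
    rw [h1, dist_self] at h12
    exact zero_ne_one h12
  have hx₁ : (x₁ : E3) ≠ 0 := by
    rw [← norm_ne_zero_iff, mem_sphere_zero_iff_norm.1 x₁.2]
    exact hr.ne'
  have hDpos : 0 < D := by linarith
  have hsin : Real.sin (β / 2) = 1 / (2 * D) := by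
    rw [hβ, mul_div_cancel_left₀ _ two_ne_zero]
    refine Real.sin_arcsin ?_ ?_
    · have : 0 < 1 / (2 * D) := by positivity
      linarith
    · rw [div_le_one (by positivity)]
      linarith
  have hb : 4 * Real.sin (β / 2) ^ 2 * (‖(x₄ : E3)‖ ^ 2 -
      inner ℝ (x₁ : E3) x₄ ^ 2 / ‖(x₁ : E3)‖ ^ 2) = 1 := by
    rw [← hD.sq_eq hx₁, hsin]
    field_simp
    norm_num
  -- Halving `β` matches the double cover: `expI (β / 2)` rotates by `β`, and the parameter has
  -- period `π`.
  have hbπ : Irrational (β / 2 / Real.pi) ∨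
      ∃ q : ℕ, Odd q ∧ ∃ m : ℕ, q * (β / 2) = m * Real.pi := by
    rcases hβπ with ⟨c, hc, rfl⟩ | ⟨p, q, hq, hpq, hp, h⟩
    · left
      have : c * Real.pi / 2 / Real.pi = c / (2 : ℕ) := by
        have := Real.pi_ne_zero
        push_cast
        field_simp
      rw [this]
      exact hc.div_natCast two_ne_zero
    · exact Or.inr (odd_multiple_half_angle hpq hp hq h)
  refine le_iInf₂ fun k hk => ?_
  by_contra hlt
  have hk4 : k ≤ 4 := by
    rw [not_le] at hlt
    have : k < 5 := by exact_mod_cast hlt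
    omega
  exact not_measurablyColorable_of_le_four hr h12 h13 h23 h24 h34 hb hbπ hk4 hk
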